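/- For integers $d\ge 1$ and $s\ge 0$ let $\mathcal E_d^{(s)}\subset\mathbb R^d$ be the set of all coefficient vectors $(a_1,\dots,a_d)$ for which the polynomial $x^d+a_1x^{d-1}+\dots+a_d$ has all its complex roots in the open unit disc and has exactly $s$ pairs of complex conjugate (non-real) roots, counted with multiplicity, and let $v_d^{(s)}$ be the $d$-dimensional Lebesgue measure of $\mathcal E_d^{(s)}$. **Theorem.** For every integer $d\ge 2$ the measures $v_d^{(0)}$ and $v_d^{(1)}$ are finite, $v_d^{(0)}>0$, and the quotient $v_d^{(1)}/v_d^{(0)}$ is an integer. Furthermore $$\frac{v_d^{(1)}}{v_d^{(0)}}=\frac{P_d(3)-2d-1}{4},$$ where $$P_d(x):=2^{-d}\sum_{k=0}^{\lfloor d/2\rfloor}(-1)^k\binom{d-k}{k}\binom{2d-2k}{d-k}x^{d-2k}=\sum_{k=0}^{d}\binom{d+k}{2k}\binom{2k}{k}\left(\frac{x-1}{2}\right)^k$$ is the $d$-th Legendre polynomial (the two expressions agree for all real $x$). -/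

import Mathlib

open MeasureTheory Polynomial

noncomputable section

/-- The monic polynomial `x ^ d + a₁ x ^ (d - 1) + ⋯ + a_d` with coefficient vector
`(a₁, …, a_d)`; the coefficient `a_{i+1}` is `a i` for `i = 0, …, d - 1`. -/
def coeffPoly {d : ℕ} (a : Fin d → ℝ) : ℝ[X] :=
  X ^ d + ∑ i : Fin d, C (a i) * X ^ (d - 1 - (i : ℕ))

/-- The coefficient vectors of the contractive polynomials: all complex roots have absolute value
less than `1`. -/
def contractiveSet (d : ℕ) : Set (Fin d → ℝ) :=
  {a | ∀ z ∈ (coeffPoly a).aroots ℂ, ‖z‖ < 1}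

/-- The number of pairs of complex conjugate (non-real) roots of a real polynomial, with
multiplicity: every pair has exactly one member in the open upper half plane. -/
def numConjPairs (p : ℝ[X]) : ℕ :=
  Multiset.card ((p.aroots ℂ).filter fun z => 0 < z.im)

/-- The coefficient vectors of the contractive polynomials of degree `d` with exactly `s` pairs of
complex conjugate roots. -/
def contractiveSetPairs (d s : ℕ) : Set (Fin d → ℝ) :=
  {a | a ∈ contractiveSet d ∧ numConjPairs (coeffPoly a) = s}

/-- The `d`-dimensional Lebesgue measure of `contractiveSetPairs d s`. -/
def contractiveVol (d s : ℕ) : ℝ :=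
  (volume (contractiveSetPairs d s)).toReal

/-- The Legendre polynomial `P_d`, as a function on the reals. -/
def legendreP (d : ℕ) (x : ℝ) : ℝ :=
  ((2 : ℝ) ^ d)⁻¹ * ∑ k ∈ Finset.range (d / 2 + 1),
    (-1 : ℝ) ^ k * ((d - k).choose k : ℝ) * ((2 * d - 2 * k).choose (d - k) : ℝ) * x ^ (d - 2 * k)

end

/-! Parametrize both sets by roots. The Jacobian of the coefficients with respect to the roots is
the Vandermonde determinant Δ up to sign, so `d! * contractiveVol d 0` is the integral of |Δ| over
the cube [-1,1]^d, called `vandMass d`. For one conjugate pair z, z̄ and n = d - 2 real roots,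
expand Δ(z, z̄, x) along the rows of z and z̄: `n! * contractiveVol d 1` becomes ∑ w_ij M_ij. The
weights w_ij are explicit integrals over the half disc, zero for i + j even and -4/((i+j+2)(i-j))
for i + j odd; M is the antisymmetric matrix `pairMoment n`.

M need not be computed, because it satisfies enough linear equations. Let u = U' be a polynomial of
degree below d with U(1) = U(-1) = 0. By Cramer's rule, u_b |Δ| is a sum over i of u(x_i) times sgn
Δ times Δ with row i replaced by the unit vector e_b. As a function of t = x_i, the sign is a step
function jumping at the other roots, so integration by parts leaves values of U at those roots, and
integrating the root in question produces pair moments: `u_b * vandMass d` = 2d(d-1) ∑_a (∫ U t^a)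
M_ba (`coeff_mul_vandMass_eq_sum_pairMoment`). The choice U = t^(e+1) - 1 with e odd yields, for
each odd column y, a Cauchy system with matrix 1/((a+1)+(e+1)) in the unknowns h_a = M_ay/(a+1), a
even. For odd d there is one unknown too many, and the vanishing of the sum of all jumps supplies ∑
h_a = 0.

By partial fractions, ∑_a w_ay M_ay is a difference of two values of ∑ h_a/((a+1)+s): one at s =
y+1, given by the system, and one at s = -(y+1), found by interpolation in `cauchy_system`. The
resulting product collapses to half the Legendre coefficient c_k = C(d+k,2k) C(2k,k) at k = y+1, so
column y contributes a common factor times c_k/2 - 1. Summing c_k over even k gives (P_d(3) +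
P_d(-1))/2, and integrality holds because C(2k,k) is even for k ≥ 1. -/

noncomputable section

/-! ### Products of signs as step functions -/

/-- The sign function, as a multiplicative map `ℝ → ℝ`. -/
def sgn : ℝ →*₀ ℝ := (SignType.castHom : SignType →*₀ ℝ).comp signHom

lemma sgn_apply (x : ℝ) : sgn x = (SignType.sign x : ℝ) := rfl

lemma sgn_of_pos {x : ℝ} (h : 0 < x) : sgn x = 1 := by simp [sgn_apply, sign_pos h]

lemma sgn_of_neg {x : ℝ} (h : x < 0) : sgn x = -1 := by simp [sgn_apply, sign_neg h]

lemma sgn_mul_self (x : ℝ) : sgn x * x = |x| := by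
  rw [sgn_apply, sign_mul_self]

lemma sgn_mul_sgn {x : ℝ} (h : x ≠ 0) : sgn x * sgn x = 1 := by
  rcases lt_or_gt_of_ne h with h | h
  · simp [sgn_of_neg h]
  · simp [sgn_of_pos h]

lemma abs_sgn_le (x : ℝ) : |sgn x| ≤ 1 := by
  rcases lt_trichotomy x 0 with h | h | h
  · simp [sgn_of_neg h]
  · simp [h]
  · simp [sgn_of_pos h]

lemma measurable_sgn : Measurable sgn := by
  have : (sgn : ℝ → ℝ) = fun x => if 0 < x then 1 else if x < 0 then -1 else 0 := by
    funext x
    rcases lt_trichotomy x 0 with h | h | h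
    · simp [sgn_of_neg h, h, h.le]
    · simp [h]
    · simp [sgn_of_pos h, h]
  rw [this]
  exact Measurable.ite measurableSet_Ioi measurable_const
    (Measurable.ite measurableSet_Iio measurable_const measurable_const)

/-- A product of sign functions, written as a step function. -/
lemma prod_sgn_sub {ι : Type*} [DecidableEq ι] (x : ι → ℝ) (t : ℝ) (s : Finset ι)
    (hx : Set.InjOn x s) (ht : ∀ i ∈ s, x i ≠ t) :
    ∏ i ∈ s, sgn (x i - t) =
      1 - 2 * ∑ i ∈ s, if x i < t then ∏ k ∈ s.erase i, sgn (x k - x i) else 0 := by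
  induction s using Finset.induction_on_max_value x with
  | empty => simp
  | insert a s has hmax ih =>
    have hlt : ∀ i ∈ s, x i < x a := fun i hi =>
      lt_of_le_of_ne (hmax i hi) fun h => has (by
        have := hx (by simp [hi]) (by simp) h
        exact this ▸ hi)
    have ih' := ih (hx.mono (by simp)) fun i hi => ht i (by simp [hi])
    have hsum : (∑ i ∈ s, if x i < t then ∏ k ∈ (insert a s).erase i, sgn (x k - x i) else 0) =
        ∑ i ∈ s, if x i < t then ∏ k ∈ s.erase i, sgn (x k - x i) else 0 := by
      refine Finset.sum_congr rfl fun i hi => ?_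
      have hne : a ≠ i := fun h => has (h ▸ hi)
      rw [Finset.erase_insert_of_ne hne, Finset.prod_insert (by simp [has]),
        sgn_of_pos (sub_pos.2 (hlt i hi)), one_mul]
    rw [Finset.prod_insert has, Finset.sum_insert has, hsum, Finset.erase_insert has]
    -- `x a` is the largest point. If t lies beyond it, all factors over `s` are -1 both at t and at
    -- `x a`, so the new summand equals the old product and flips its sign. Otherwise the new factor
    -- is 1 and the new summand is absent.
    rcases lt_or_gt_of_ne (ht a (by simp)) with h | h
    · have h1 : ∏ i ∈ s, sgn (x i - x a) = ∏ i ∈ s, sgn (x i - t) :=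
        Finset.prod_congr rfl fun i hi => by
          rw [sgn_of_neg (sub_neg.2 (hlt i hi)), sgn_of_neg (sub_neg.2 ((hlt i hi).trans h))]
      rw [if_pos h, h1, sgn_of_neg (sub_neg.2 h)]
      linarith
    · rw [if_neg h.not_gt, sgn_of_pos (sub_pos.2 h)]
      linarith

/-- For an even number of points the residues of `∏ sgn (x i - t)` sum to zero. -/
lemma sum_prod_sgn_eq_zero {ι : Type*} [DecidableEq ι] (x : ι → ℝ) (s : Finset ι)
    (hx : Set.InjOn x s) (hs : Even s.card) :
    ∑ i ∈ s, ∏ k ∈ s.erase i, sgn (x k - x i) = 0 := by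
  -- To the right of all points the product of an even number of signs is 1, while `prod_sgn_sub`
  -- gives 1 minus twice the full sum.
  obtain ⟨t, ht⟩ : ∃ t, ∀ i ∈ s, x i < t := by
    obtain ⟨M, hM⟩ := (s.image x).bddAbove
    exact ⟨M + 1, fun i hi => lt_of_le_of_lt (hM (by simpa using ⟨i, hi, rfl⟩)) (lt_add_one M)⟩
  have h := prod_sgn_sub x t s hx fun i hi => (ht i hi).ne
  rw [Finset.prod_congr rfl fun i hi => sgn_of_neg (sub_neg.2 (ht i hi)),
    Finset.sum_congr rfl fun i hi => if_pos (ht i hi), Finset.prod_const, hs.neg_one_pow] at h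
  linarith

/-! ### Integration over the cube -/

/-- Lebesgue measure on the cube `[-1, 1] ^ n`. -/
def cubeMeasure (n : ℕ) : Measure (Fin n → ℝ) :=
  Measure.pi fun _ => volume.restrict (Set.Icc (-1) 1)

instance (n : ℕ) : IsFiniteMeasure (cubeMeasure n) := by
  unfold cubeMeasure; infer_instance

lemma cubeMeasure_eq (n : ℕ) :
    cubeMeasure n = volume.restrict (Set.univ.pi fun _ => Set.Icc (-1) 1) := by
  rw [cubeMeasure, ← Measure.restrict_pi_pi, volume_pi]

lemma integrable_cube {n : ℕ} {s g : (Fin n → ℝ) → ℝ} (hs : Measurable s)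
    (hb : ∀ x, |s x| ≤ 1) (hg : Continuous g) :
    Integrable (fun x => s x * g x) (cubeMeasure n) := by
  refine Integrable.bdd_mul (c := 1) ?_ hs.aestronglyMeasurable (Filter.Eventually.of_forall hb)
  rw [cubeMeasure_eq]
  exact hg.continuousOn.integrableOn_compact (isCompact_univ_pi fun _ => isCompact_Icc)

lemma ae_injective_cube (n : ℕ) : ∀ᵐ x ∂cubeMeasure n, Function.Injective x := by
  have h : ∀ᵐ x : Fin n → ℝ, Function.Injective x := by
    have : ∀ i j : Fin n, ∀ᵐ x : Fin n → ℝ, i ≠ j → x i ≠ x j := by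
      intro i j
      by_cases hij : i = j
      · simp [hij]
      let p : Submodule ℝ (Fin n → ℝ) :=
        LinearMap.ker ((LinearMap.proj i : (Fin n → ℝ) →ₗ[ℝ] ℝ) - LinearMap.proj j)
      have hp : p ≠ ⊤ := by
        intro h
        have h1 : (Pi.single i 1 : Fin n → ℝ) ∈ p := h ▸ Submodule.mem_top
        simp [p, Ne.symm hij] at h1
      have h0 := Measure.addHaar_submodule volume p hp
      rw [ae_iff]
      refine measure_mono_null ?_ h0
      intro x hx
      simp only [Set.mem_ofPred_eq, not_forall, not_not] at hx
      simpa [p, sub_eq_zero] using hx.2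
    simp only [← ae_all_iff] at this
    filter_upwards [this] with x hx i j
    exact not_imp_not.1 (hx i j)
  rw [cubeMeasure_eq]
  exact ae_restrict_of_ae h

lemma integral_cube_perm {n : ℕ} (σ : Equiv.Perm (Fin n)) (f : (Fin n → ℝ) → ℝ) :
    ∫ x, f (x ∘ σ) ∂cubeMeasure n = ∫ x, f x ∂cubeMeasure n := by
  have h := measurePreserving_piCongrLeft
    (fun _ : Fin n => (volume.restrict (Set.Icc (-1) 1) : Measure ℝ)) σ.symm
  have h2 := h.integral_comp' (g := f)
  rw [cubeMeasure, ← h2]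
  congr 1
  funext x
  congr 1
  funext i
  have h3 := Equiv.piCongrLeft_apply_apply (fun _ => ℝ) σ.symm x (σ i)
  rw [Equiv.symm_apply_apply] at h3
  exact h3.symm

/-- Both orders are needed: the distinguished point is integrated innermost for the integration by
parts, and outermost when the pair moments are split off. -/
lemma integral_cube_succ {n : ℕ} {f : (Fin (n + 1) → ℝ) → ℝ}
    (hf : Integrable f (cubeMeasure (n + 1))) :
    ∫ x, f x ∂cubeMeasure (n + 1) =
      ∫ t in Set.Icc (-1 : ℝ) 1, ∫ x, f (Fin.cons t x) ∂cubeMeasure n ∧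
    ∫ x, f x ∂cubeMeasure (n + 1) =
      ∫ x, (∫ t in Set.Icc (-1 : ℝ) 1, f (Fin.cons t x)) ∂cubeMeasure n := by
  have h := measurePreserving_piFinSuccAbove
    (fun _ : Fin (n + 1) => (volume.restrict (Set.Icc (-1) 1) : Measure ℝ)) 0
  have h' := h.symm
  have hint : Integrable (fun p : ℝ × (Fin n → ℝ) => f (Fin.cons p.1 p.2))
      ((volume.restrict (Set.Icc (-1) 1)).prod (cubeMeasure n)) := by
    have := (h'.integrable_comp_emb (MeasurableEquiv.measurableEmbedding _)).2 hf
    refine this.congr (Filter.Eventually.of_forall fun p => ?_)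
    simp [MeasurableEquiv.piFinSuccAbove, Fin.insertNthEquiv]
  have heq : ∫ x, f x ∂cubeMeasure (n + 1) = ∫ p : ℝ × (Fin n → ℝ), f (Fin.cons p.1 p.2)
      ∂((volume.restrict (Set.Icc (-1) 1)).prod (cubeMeasure n)) := by
    rw [cubeMeasure, ← h'.integral_comp' (g := f)]
    congr 1
    funext p
    simp [MeasurableEquiv.piFinSuccAbove, Fin.insertNthEquiv]
  exact ⟨heq.trans (integral_prod _ hint), heq.trans (integral_prod_symm _ hint)⟩

/-! ### Vandermonde signs and determinants with prescribed rows -/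

/-- The sign of the Vandermonde determinant. -/
def vandSgn {n : ℕ} (x : Fin n → ℝ) : ℝ := sgn (Matrix.vandermonde x).det

lemma continuous_det_vandermonde (n : ℕ) :
    Continuous fun x : Fin n → ℝ => (Matrix.vandermonde x).det := by
  simp only [Matrix.det_vandermonde]
  fun_prop

lemma measurable_vandSgn (n : ℕ) : Measurable (vandSgn : (Fin n → ℝ) → ℝ) :=
  measurable_sgn.comp (continuous_det_vandermonde n).measurable

lemma abs_vandSgn_le {n : ℕ} (x : Fin n → ℝ) : |vandSgn x| ≤ 1 := abs_sgn_le _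

/-- As a function of its first point, the Vandermonde sign is the step function of `prod_sgn_sub`.
-/
lemma vandSgn_cons {n : ℕ} (t : ℝ) (x : Fin n → ℝ) :
    vandSgn (Fin.cons t x) = (∏ i, sgn (x i - t)) * vandSgn x := by
  simp only [vandSgn, Matrix.det_vandermonde, Fin.prod_univ_succ, map_mul, map_prod,
    Fin.prod_Ioi_zero, Fin.prod_Ioi_succ, Fin.cons_zero, Fin.cons_succ]

lemma vandermonde_comp {n : ℕ} (σ : Equiv.Perm (Fin n)) (x : Fin n → ℝ) :
    Matrix.vandermonde (x ∘ σ) = (Matrix.vandermonde x).submatrix σ id := rfl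

lemma sgn_permSign {n : ℕ} (σ : Equiv.Perm (Fin n)) :
    sgn ((Equiv.Perm.sign σ : ℤ) : ℝ) = ((Equiv.Perm.sign σ : ℤ) : ℝ) := by
  rcases Int.units_eq_one_or (Equiv.Perm.sign σ) with h | h <;> simp [h, sgn_of_neg]

lemma permSign_mul_self {n : ℕ} (σ : Equiv.Perm (Fin n)) :
    ((Equiv.Perm.sign σ : ℤ) : ℝ) * ((Equiv.Perm.sign σ : ℤ) : ℝ) = 1 := by
  rcases Int.units_eq_one_or (Equiv.Perm.sign σ) with h | h <;> simp [h]

lemma vandSgn_comp {n : ℕ} (σ : Equiv.Perm (Fin n)) (x : Fin n → ℝ) :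
    vandSgn (x ∘ σ) = ((Equiv.Perm.sign σ : ℤ) : ℝ) * vandSgn x := by
  rw [vandSgn, vandermonde_comp, Matrix.det_permute, map_mul, sgn_permSign, vandSgn]

/-- The rows `(1, x_i, x_i ^ 2, …)` of length `d`. -/
def powRows {n : ℕ} (d : ℕ) (x : Fin n → ℝ) : Fin n → Fin d → ℝ := fun i j => x i ^ (j : ℕ)

/-- The determinant whose first row is `r` and whose other rows are those of `A`. -/
def detCons {R : Type*} [CommRing R] {n : ℕ} (r : Fin (n + 1) → R) (A : Fin n → Fin (n + 1) → R) : R :=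
  (Matrix.of (Matrix.vecCons r A)).det

lemma detCons_eq_sum {R : Type*} [CommRing R] {n : ℕ} (r : Fin (n + 1) → R)
    (A : Fin n → Fin (n + 1) → R) :
    detCons r A = ∑ j : Fin (n + 1), (-1) ^ (j : ℕ) * r j *
      ((Matrix.of A).submatrix id j.succAbove).det := by
  rw [detCons, Matrix.det_succ_row_zero]
  rfl

lemma detCons_comp {n : ℕ} (r : Fin (n + 1) → ℝ) (A : Fin n → Fin (n + 1) → ℝ)
    (σ : Equiv.Perm (Fin n)) :
    detCons r (A ∘ σ) = ((Equiv.Perm.sign σ : ℤ) : ℝ) * detCons r A := by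
  simp only [detCons_eq_sum, Finset.mul_sum]
  refine Finset.sum_congr rfl fun j _ => ?_
  have : (Matrix.of (A ∘ σ)).submatrix id j.succAbove =
      ((Matrix.of A).submatrix id j.succAbove).submatrix σ id := rfl
  rw [this, Matrix.det_permute]
  ring

lemma detCons_swap {R : Type*} [CommRing R] {n : ℕ} (r s : Fin (n + 2) → R)
    (A : Fin n → Fin (n + 2) → R) :
    detCons r (Matrix.vecCons s A) = -detCons s (Matrix.vecCons r A) := by
  have h := Matrix.det_permute (Equiv.swap (0 : Fin (n + 2)) 1)
    (Matrix.of (Matrix.vecCons s (Matrix.vecCons r A)))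
  rw [Equiv.Perm.sign_swap (by simp)] at h
  simp only [Units.val_neg, Units.val_one, Int.cast_neg, Int.cast_one, neg_mul, one_mul] at h
  rw [detCons, detCons, ← h]
  congr 1
  ext i j
  refine Fin.cases ?_ (fun i => Fin.cases ?_ (fun i => ?_) i) i
  · simp
  · simp
  · have : Equiv.swap (0 : Fin (n + 2)) 1 i.succ.succ = i.succ.succ :=
      Equiv.swap_apply_of_ne_of_ne (Fin.succ_ne_zero _)
        (by simp [Fin.ext_iff])
    simp [this]

lemma detCons_second_eq_sum {R : Type*} [CommRing R] {n : ℕ} (r s : Fin (n + 2) → R)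
    (A : Fin n → Fin (n + 2) → R) :
    detCons r (Matrix.vecCons s A) =
      ∑ a, s a * detCons r (Matrix.vecCons (Pi.single a 1) A) := by
  rw [detCons_swap, detCons_eq_sum, ← Finset.sum_neg_distrib]
  refine Finset.sum_congr rfl fun a _ => ?_
  rw [detCons_swap, detCons_eq_sum, Finset.sum_eq_single a]
  · simp only [Pi.single_eq_same]
    ring
  · intro b _ hb
    simp [hb]
  · simp

lemma det_updateRow_zero_cons {n : ℕ} (r : Fin (n + 1) → ℝ) (t : ℝ) (x : Fin n → ℝ) :
    ((Matrix.vandermonde (Fin.cons t x : Fin (n + 1) → ℝ)).updateRow 0 r).det =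
      detCons r (powRows (n + 1) x) := by
  rw [detCons]
  congr 1
  ext i j
  refine Fin.cases ?_ (fun i => ?_) i
  · rw [Matrix.updateRow_self]
    rfl
  · rw [Matrix.updateRow_ne (Fin.succ_ne_zero i), Matrix.vandermonde_apply, Fin.cons_succ]
    rfl

lemma det_updateRow_comp {n : ℕ} (r : Fin n → ℝ) (i : Fin n) (σ : Equiv.Perm (Fin n))
    (x : Fin n → ℝ) :
    ((Matrix.vandermonde (x ∘ σ)).updateRow i r).det =
      ((Equiv.Perm.sign σ : ℤ) : ℝ) * ((Matrix.vandermonde x).updateRow (σ i) r).det := by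
  rw [← Matrix.det_permute]
  congr 1
  ext k j
  by_cases h : k = i
  · subst h; simp
  · have : σ k ≠ σ i := fun h' => h (σ.injective h')
    simp [Matrix.updateRow_ne h, Matrix.updateRow_ne this, Matrix.vandermonde_apply]

/-- Cramer's rule: the replaced-row determinants are the entries of the adjugate, and adj(W) W = det
W. For a Vandermonde matrix W, the inner sums are the values of the polynomial u at the points. -/
lemma sum_mul_det_updateRow {n : ℕ} (W : Matrix (Fin n) (Fin n) ℝ) (u : Fin n → ℝ) (b : Fin n) :
    ∑ i, (∑ j, W i j * u j) * (W.updateRow i (Pi.single b 1)).det = u b * W.det := by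
  have h : (W.adjugate.mulVec (W.mulVec u)) b = W.det * u b := by
    rw [Matrix.mulVec_mulVec, Matrix.adjugate_mul, Matrix.smul_mulVec, Matrix.one_mulVec]
    rfl
  rw [mul_comm, ← h, Matrix.mulVec, dotProduct]
  refine Finset.sum_congr rfl fun i _ => ?_
  rw [Matrix.adjugate_apply, mul_comm]
  rfl

lemma continuous_detCons_powRows {n : ℕ} (r : Fin (n + 1) → ℝ) :
    Continuous fun x : Fin n → ℝ => detCons r (powRows (n + 1) x) := by
  simp only [detCons_eq_sum]
  refine continuous_finsetSum _ fun j _ => continuous_const.mul (Continuous.matrix_det ?_)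
  refine continuous_matrix fun i k => ?_
  simp only [Matrix.submatrix_apply, Matrix.of_apply, powRows]
  fun_prop

lemma continuous_det_updateRow {n : ℕ} (i : Fin n) (r : Fin n → ℝ) :
    Continuous fun x : Fin n → ℝ => ((Matrix.vandermonde x).updateRow i r).det := by
  refine Continuous.matrix_det ?_
  refine Continuous.matrix_updateRow _ ?_ continuous_const
  exact continuous_matrix fun i k => by simp only [Matrix.vandermonde_apply]; fun_prop

/-! ### Integration by parts and pair moments -/

/-- `∫ |Δ|` over the cube. -/
def vandMass (n : ℕ) : ℝ := ∫ x, |(Matrix.vandermonde x).det| ∂cubeMeasure n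

/-- Swapping the points 0 and i multiplies both the Vandermonde sign and the determinant by the sign
of the permutation; these cancel. -/
lemma integral_swap_updateRow {n : ℕ} (φ : ℝ → ℝ) (r : Fin (n + 1) → ℝ) (i : Fin (n + 1)) :
    ∫ x, vandSgn x * (φ (x i) * ((Matrix.vandermonde x).updateRow i r).det)
      ∂cubeMeasure (n + 1) =
    ∫ x, vandSgn x * (φ (x 0) * ((Matrix.vandermonde x).updateRow 0 r).det)
      ∂cubeMeasure (n + 1) := by
  rw [← integral_cube_perm (Equiv.swap 0 i)]
  congr 1
  funext x
  rw [vandSgn_comp, det_updateRow_comp, Equiv.swap_apply_right, Function.comp_apply,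
    Equiv.swap_apply_right]
  linear_combination (vandSgn x * (φ (x 0) * ((Matrix.vandermonde x).updateRow 0 r).det)) *
    permSign_mul_self (Equiv.swap 0 i)

/-- Expansion of `∫ |Δ|` along the values of a polynomial. -/
lemma coeff_mul_vandMass {n : ℕ} (u : Fin (n + 1) → ℝ) (b : Fin (n + 1)) :
    u b * vandMass (n + 1) = (n + 1) * ∫ x, (vandSgn x * detCons (Pi.single b 1) (powRows (n + 1) x))
      * (∫ t in Set.Icc (-1 : ℝ) 1, (∑ j : Fin (n + 1), t ^ (j : ℕ) * u j) * ∏ i, sgn (x i - t))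
      ∂cubeMeasure n := by
  have hcont : Continuous fun t : ℝ => ∑ j : Fin (n + 1), t ^ (j : ℕ) * u j := by fun_prop
  have hint : ∀ i : Fin (n + 1), Integrable (fun x => vandSgn x * ((∑ j : Fin (n + 1), x i ^ (j : ℕ) * u j) *
      ((Matrix.vandermonde x).updateRow i (Pi.single b 1)).det)) (cubeMeasure (n + 1)) := fun i =>
    integrable_cube (measurable_vandSgn _) abs_vandSgn_le
      ((hcont.comp (continuous_apply i)).mul (continuous_det_updateRow i _))
  have h1 : u b * vandMass (n + 1) = ∑ i : Fin (n + 1), ∫ x, vandSgn x *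
      ((∑ j : Fin (n + 1), x i ^ (j : ℕ) * u j) * ((Matrix.vandermonde x).updateRow i (Pi.single b 1)).det)
      ∂cubeMeasure (n + 1) := by
    rw [← integral_finsetSum _ fun i _ => hint i, vandMass, ← integral_const_mul]
    congr 1
    funext x
    rw [← Finset.mul_sum, ← sgn_mul_self, mul_left_comm, vandSgn]
    congr 1
    exact (sum_mul_det_updateRow (Matrix.vandermonde x) u b).symm
  rw [h1, Finset.sum_congr rfl fun i _ => integral_swap_updateRow (fun t => ∑ j : Fin (n + 1), t ^ (j : ℕ) * u j) _ i,
    Finset.sum_const, Finset.card_univ, Fintype.card_fin, nsmul_eq_mul,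
    (integral_cube_succ (hint 0)).2]
  push_cast
  congr 2
  funext x
  rw [← integral_const_mul]
  congr 1
  funext t
  rw [det_updateRow_zero_cons, vandSgn_cons, Fin.cons_zero]
  ring

/-- Integration by parts against the step function: its jump at `x i` is -2 times the product of the
other signs there, and the boundary terms vanish because U does at both endpoints. -/
lemma integral_mul_prod_sgn {n : ℕ} (U u : ℝ → ℝ) (hU : ∀ t, HasDerivAt U (u t) t)
    (hu : Continuous u) (h1 : U 1 = 0) (h2 : U (-1) = 0) (x : Fin n → ℝ)
    (hx : Function.Injective x) (hmem : ∀ i, x i ∈ Set.Icc (-1 : ℝ) 1) :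
    ∫ t in Set.Icc (-1 : ℝ) 1, u t * ∏ i, sgn (x i - t) =
      2 * ∑ i, (∏ k ∈ Finset.univ.erase i, sgn (x k - x i)) * U (x i) := by
  classical
  have hae : ∀ᵐ t ∂(volume.restrict (Set.Icc (-1 : ℝ) 1)), ∀ i, x i ≠ t := by
    refine ae_restrict_of_ae ?_
    rw [ae_all_iff]
    intro i
    have : ∀ᵐ t : ℝ, t ≠ x i := Measure.ae_ne volume (x i)
    filter_upwards [this] with t ht using ht.symm
  have hstep : ∀ᵐ t ∂(volume.restrict (Set.Icc (-1 : ℝ) 1)), u t * ∏ i, sgn (x i - t) =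
      u t - ∑ i, (2 * ∏ k ∈ Finset.univ.erase i, sgn (x k - x i)) *
        (Set.Ioi (x i)).indicator u t := by
    filter_upwards [hae] with t ht
    rw [prod_sgn_sub x t Finset.univ hx.injOn fun i _ => ht i, mul_sub, mul_one, Finset.mul_sum,
      Finset.mul_sum]
    congr 1
    refine Finset.sum_congr rfl fun i _ => ?_
    by_cases h : x i < t
    · simp [h]; ring
    · simp [h]
  have hI : IntegrableOn u (Set.Icc (-1 : ℝ) 1) := hu.continuousOn.integrableOn_Icc
  have hFTC : ∀ a b : ℝ, ∫ t in a..b, u t = U b - U a := fun a b =>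
    intervalIntegral.integral_eq_sub_of_hasDerivAt (fun t _ => hU t) (hu.intervalIntegrable _ _)
  rw [integral_congr_ae hstep, integral_sub hI, integral_finsetSum]
  · rw [integral_Icc_eq_integral_Ioc, ← intervalIntegral.integral_of_le (by norm_num), hFTC, h1, h2,
      Finset.mul_sum, sub_zero, zero_sub, ← Finset.sum_neg_distrib]
    refine Finset.sum_congr rfl fun i _ => ?_
    rw [integral_const_mul, integral_indicator measurableSet_Ioi,
      Measure.restrict_restrict measurableSet_Ioi]
    have : Set.Ioi (x i) ∩ Set.Icc (-1) 1 = Set.Ioc (x i) 1 := by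
      ext t
      have := (hmem i).1
      simp only [Set.mem_inter_iff, Set.mem_Ioi, Set.mem_Icc, Set.mem_Ioc]
      constructor
      · rintro ⟨a, -, b⟩; exact ⟨a, b⟩
      · rintro ⟨a, b⟩; exact ⟨a, by linarith, b⟩
    rw [this, ← intervalIntegral.integral_of_le (hmem i).2, hFTC, h1]
    ring
  · exact fun i _ => (hI.indicator measurableSet_Ioi).const_mul _
  · exact integrable_finsetSum _ fun i _ => (hI.indicator measurableSet_Ioi).const_mul _

/-- The moments of the pairs of rows complementary to `n` points. -/
def pairMoment (n : ℕ) (a b : Fin (n + 2)) : ℝ :=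
  ∫ x, vandSgn x * detCons (Pi.single a 1) (Matrix.vecCons (Pi.single b 1) (powRows (n + 2) x))
    ∂cubeMeasure n

lemma pairMoment_antisymm (n : ℕ) (a b : Fin (n + 2)) : pairMoment n a b = -pairMoment n b a := by
  rw [pairMoment, pairMoment, ← integral_neg]
  congr 1
  funext x
  rw [detCons_swap]
  ring

lemma continuous_detCons_two {n : ℕ} (r s : Fin (n + 2) → ℝ) :
    Continuous fun x : Fin n → ℝ => detCons r (Matrix.vecCons s (powRows (n + 2) x)) := by
  simp only [detCons_eq_sum]
  refine continuous_finsetSum _ fun j _ => continuous_const.mul (Continuous.matrix_det ?_)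
  refine continuous_matrix fun i k => ?_
  refine Fin.cases ?_ (fun i => ?_) i
  · simpa using continuous_const
  · simp only [Matrix.submatrix_apply, Matrix.of_apply, id, Matrix.cons_val_succ, powRows]
    fun_prop

lemma prod_erase_zero {n : ℕ} (f : Fin (n + 1) → ℝ) :
    ∏ k ∈ Finset.univ.erase 0, f k = ∏ k : Fin n, f k.succ := by
  have : (Finset.univ.erase 0 : Finset (Fin (n + 1))) = Finset.univ.image Fin.succ := by
    ext k
    refine Fin.cases ?_ (fun k => ?_) k <;> simp [Fin.succ_ne_zero]
  rw [this, Finset.prod_image fun a _ b _ h => Fin.succ_injective _ h]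

/-- The swap argument of `integral_swap_updateRow`; the product of the other signs is carried along
by relabelling. -/
lemma integral_swap_residue {n : ℕ} (φ : ℝ → ℝ) (r : Fin (n + 2) → ℝ) (i : Fin (n + 1)) :
    ∫ x, vandSgn x * detCons r (powRows (n + 2) x) *
      ((∏ k ∈ Finset.univ.erase i, sgn (x k - x i)) * φ (x i)) ∂cubeMeasure (n + 1) =
    ∫ x, vandSgn x * detCons r (powRows (n + 2) x) *
      ((∏ k ∈ Finset.univ.erase 0, sgn (x k - x 0)) * φ (x 0)) ∂cubeMeasure (n + 1) := by
  rw [← integral_cube_perm (Equiv.swap 0 i)]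
  congr 1
  funext x
  have h1 : powRows (n + 2) (x ∘ Equiv.swap 0 i) = powRows (n + 2) x ∘ Equiv.swap 0 i := rfl
  have h2 : ∏ k ∈ Finset.univ.erase i, sgn (x (Equiv.swap 0 i k) - x 0) =
      ∏ k ∈ Finset.univ.erase 0, sgn (x k - x 0) := by
    refine Finset.prod_bij (fun k _ => Equiv.swap 0 i k) ?_ ?_ ?_ ?_
    · intro k hk
      simp only [Finset.mem_erase, Finset.mem_univ, and_true] at hk ⊢
      intro h
      exact hk (by rw [Equiv.swap_apply_eq_iff.1 h, Equiv.swap_apply_left])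
    · exact fun a _ b _ h => (Equiv.swap 0 i).injective h
    · intro k hk
      refine ⟨Equiv.swap 0 i k, ?_, Equiv.swap_apply_self _ _ _⟩
      simp only [Finset.mem_erase, Finset.mem_univ, and_true] at hk ⊢
      intro h
      exact hk (by rw [Equiv.swap_apply_eq_iff.1 h, Equiv.swap_apply_right])
    · exact fun _ _ => rfl
  simp only [Function.comp_apply, Equiv.swap_apply_right, vandSgn_comp, h1, detCons_comp, h2]
  linear_combination (vandSgn x * detCons r (powRows (n + 2) x) *
      ((∏ k ∈ Finset.univ.erase 0, sgn (x k - x 0)) * φ (x 0))) *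
    permSign_mul_self (Equiv.swap 0 i)

lemma measurable_prod_sgn {n : ℕ} (i : Fin n) :
    Measurable fun x : Fin n → ℝ => ∏ k ∈ Finset.univ.erase i, sgn (x k - x i) :=
  Finset.measurable_prod _ fun k _ =>
    measurable_sgn.comp ((measurable_pi_apply k).sub (measurable_pi_apply i))

lemma abs_prod_sgn_le {n : ℕ} (i : Fin n) (x : Fin n → ℝ) :
    |∏ k ∈ Finset.univ.erase i, sgn (x k - x i)| ≤ 1 := by
  rw [Finset.abs_prod]
  exact Finset.prod_le_one (fun _ _ => abs_nonneg _) fun _ _ => abs_sgn_le _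

lemma integrable_residue {n : ℕ} (φ : ℝ → ℝ) (hφ : Continuous φ) (r : Fin (n + 2) → ℝ)
    (i : Fin (n + 1)) :
    Integrable (fun x => vandSgn x * detCons r (powRows (n + 2) x) *
      ((∏ k ∈ Finset.univ.erase i, sgn (x k - x i)) * φ (x i))) (cubeMeasure (n + 1)) := by
  have := integrable_cube (n := n + 1)
    (s := fun x => vandSgn x * ∏ k ∈ Finset.univ.erase i, sgn (x k - x i))
    (g := fun x => detCons r (powRows (n + 2) x) * φ (x i))
    ((measurable_vandSgn _).mul (measurable_prod_sgn i))
    (fun x => by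
      rw [abs_mul]
      exact mul_le_one₀ (abs_vandSgn_le x) (abs_nonneg _) (abs_prod_sgn_le i x))
    ((continuous_detCons_powRows r).mul (hφ.comp (continuous_apply i)))
  refine this.congr (Filter.Eventually.of_forall fun x => ?_)
  simp only
  ring

/-- The sum over the residues reduces to the pair moments. -/
lemma integral_sum_residue {n : ℕ} (φ : ℝ → ℝ) (hφ : Continuous φ) (b : Fin (n + 2)) :
    ∫ x, vandSgn x * detCons (Pi.single b 1) (powRows (n + 2) x) *
      ∑ i, (∏ k ∈ Finset.univ.erase i, sgn (x k - x i)) * φ (x i) ∂cubeMeasure (n + 1) =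
    (n + 1) * ∑ a : Fin (n + 2), (∫ t in Set.Icc (-1 : ℝ) 1, φ t * t ^ (a : ℕ)) *
      pairMoment n b a := by
  simp only [Finset.mul_sum]
  rw [integral_finsetSum _ fun i _ => integrable_residue φ hφ _ i,
    Finset.sum_congr rfl fun i _ => integral_swap_residue φ _ i,
    Finset.sum_const, Finset.card_univ, Fintype.card_fin, nsmul_eq_mul, ← Finset.mul_sum,
    (integral_cube_succ (integrable_residue φ hφ _ 0)).1]
  push_cast
  congr 1
  have hint : ∀ a : Fin (n + 2), Integrable (fun x : Fin n → ℝ => vandSgn x *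
      detCons (Pi.single b 1) (Matrix.vecCons (Pi.single a 1) (powRows (n + 2) x)))
      (cubeMeasure n) := fun a =>
    integrable_cube (measurable_vandSgn _) abs_vandSgn_le (continuous_detCons_two _ _)
  have hinner : ∀ t : ℝ, ∫ x : Fin n → ℝ, vandSgn (Fin.cons t x : Fin (n + 1) → ℝ) *
      detCons (Pi.single b 1) (powRows (n + 2) (Fin.cons t x : Fin (n + 1) → ℝ)) *
      ((∏ k ∈ Finset.univ.erase 0, sgn ((Fin.cons t x : Fin (n + 1) → ℝ) k -
        (Fin.cons t x : Fin (n + 1) → ℝ) 0)) * φ ((Fin.cons t x : Fin (n + 1) → ℝ) 0))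
      ∂cubeMeasure n = ∑ a : Fin (n + 2), (φ t * t ^ (a : ℕ)) * pairMoment n b a := by
    intro t
    have hne : ∀ᵐ x ∂cubeMeasure n, ∀ k, x k - t ≠ 0 := by
      have h0 : ∀ᵐ x : Fin n → ℝ, ∀ k, x k - t ≠ 0 := by
        rw [ae_all_iff]
        intro k
        have := (Measure.quasiMeasurePreserving_eval (fun _ : Fin n => (volume : Measure ℝ)) k).ae
          (Measure.ae_ne volume t)
        rw [volume_pi]
        filter_upwards [this] with x hx using sub_ne_zero.2 hx
      rw [cubeMeasure_eq]
      exact ae_restrict_of_ae h0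
    have hpt : ∀ᵐ x ∂cubeMeasure n, vandSgn (Fin.cons t x : Fin (n + 1) → ℝ) *
        detCons (Pi.single b 1) (powRows (n + 2) (Fin.cons t x : Fin (n + 1) → ℝ)) *
        ((∏ k ∈ Finset.univ.erase 0, sgn ((Fin.cons t x : Fin (n + 1) → ℝ) k -
          (Fin.cons t x : Fin (n + 1) → ℝ) 0)) * φ ((Fin.cons t x : Fin (n + 1) → ℝ) 0)) =
        ∑ a : Fin (n + 2), (φ t * t ^ (a : ℕ)) * (vandSgn x *
          detCons (Pi.single b 1) (Matrix.vecCons (Pi.single a 1) (powRows (n + 2) x))) := by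
      filter_upwards [hne] with x hx
      have hrows : powRows (n + 2) (Fin.cons t x : Fin (n + 1) → ℝ) =
          Matrix.vecCons (fun a : Fin (n + 2) => t ^ (a : ℕ)) (powRows (n + 2) x) := by
        funext i j
        refine Fin.cases ?_ (fun i => ?_) i <;> simp [powRows]
      -- The sign split off `vandSgn` at the first point t and the residue at t are the same
      -- product, so they cancel wherever no `x k` equals t.
      have hsq : (∏ k, sgn (x k - t)) * ∏ k, sgn (x k - t) = 1 := by
        rw [← Finset.prod_mul_distrib]
        exact Finset.prod_eq_one fun k _ => sgn_mul_sgn (hx k)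
      rw [vandSgn_cons, prod_erase_zero, hrows, detCons_second_eq_sum]
      simp only [Fin.cons_succ, Fin.cons_zero]
      rw [Finset.mul_sum, Finset.sum_mul]
      refine Finset.sum_congr rfl fun a _ => ?_
      linear_combination (φ t * t ^ (a : ℕ) * (vandSgn x *
          detCons (Pi.single b 1) (Matrix.vecCons (Pi.single a 1) (powRows (n + 2) x)))) * hsq
    rw [integral_congr_ae hpt, integral_finsetSum _ fun a _ => (hint a).const_mul _]
    simp only [integral_const_mul, pairMoment]
  simp only [hinner]
  rw [integral_finsetSum]
  · simp only [integral_mul_const]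
  · intro a _
    exact ((hφ.mul (continuous_pow _)).continuousOn.integrableOn_Icc).mul_const _

lemma ae_mem_cube (n : ℕ) : ∀ᵐ x ∂cubeMeasure n, ∀ i, x i ∈ Set.Icc (-1 : ℝ) 1 := by
  rw [cubeMeasure_eq]
  filter_upwards [ae_restrict_mem (MeasurableSet.univ_pi fun _ => measurableSet_Icc)] with x hx i
  exact hx i trivial

/-- Integration by parts relation between the mass of the Vandermonde determinant and the
pair moments. -/
theorem coeff_mul_vandMass_eq_sum_pairMoment {n : ℕ} (u : Fin (n + 2) → ℝ) (U : ℝ → ℝ)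
    (hU : ∀ t, HasDerivAt U (∑ j : Fin (n + 2), t ^ (j : ℕ) * u j) t) (h1 : U 1 = 0) (h2 : U (-1) = 0)
    (b : Fin (n + 2)) :
    u b * vandMass (n + 2) = 2 * (n + 2) * (n + 1) * ∑ a : Fin (n + 2),
      (∫ t in Set.Icc (-1 : ℝ) 1, U t * t ^ (a : ℕ)) * pairMoment n b a := by
  have hUc : Continuous U := continuous_iff_continuousAt.2 fun t => (hU t).continuousAt
  have key := integral_sum_residue U hUc b
  rw [coeff_mul_vandMass u b]
  have : ∀ᵐ x ∂cubeMeasure (n + 1),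
      (vandSgn x * detCons (Pi.single b 1) (powRows (n + 1 + 1) x)) *
      (∫ t in Set.Icc (-1 : ℝ) 1, (∑ j : Fin (n + 2), t ^ (j : ℕ) * u j) * ∏ i, sgn (x i - t)) =
      2 * (vandSgn x * detCons (Pi.single b 1) (powRows (n + 2) x) *
      ∑ i, (∏ k ∈ Finset.univ.erase i, sgn (x k - x i)) * U (x i)) := by
    filter_upwards [ae_injective_cube (n + 1), ae_mem_cube (n + 1)] with x hx hm
    rw [integral_mul_prod_sgn U _ hU (by fun_prop) h1 h2 x hx hm]
    ring
  rw [integral_congr_ae this, integral_const_mul, key]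
  push_cast
  ring

/-- For an odd total number of points the pair moments are orthogonal to the constants. -/
theorem sum_integral_pow_mul_pairMoment_eq_zero {n : ℕ} (hn : Even (n + 1)) (b : Fin (n + 2)) :
    ∑ a : Fin (n + 2), (∫ t in Set.Icc (-1 : ℝ) 1, t ^ (a : ℕ)) * pairMoment n b a = 0 := by
  -- With φ = 1 the integrand contains the sum of the residues of n + 1 points, which vanishes for n
  -- + 1 even.
  have key := integral_sum_residue (fun _ => 1) continuous_const b
  have : ∀ᵐ x ∂cubeMeasure (n + 1), vandSgn x * detCons (Pi.single b 1) (powRows (n + 2) x) *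
      ∑ i, (∏ k ∈ Finset.univ.erase i, sgn (x k - x i)) * 1 = 0 := by
    filter_upwards [ae_injective_cube (n + 1)] with x hx
    simp only [mul_one]
    rw [sum_prod_sgn_eq_zero x Finset.univ hx.injOn (by simpa using hn), mul_zero]
  rw [integral_congr_ae this, integral_zero] at key
  simp only [one_mul] at key
  have hpos : ((n : ℝ) + 1) ≠ 0 := by positivity
  exact (mul_eq_zero.1 key.symm).resolve_left hpos

/-! ### Jacobian of the coefficients as functions of the roots -/

/-- The product is affine in each root, with slope minus the product of the other factors. The
induction runs over all coefficients at once, since multiplying by X - c mixes neighbouring ones. -/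
lemma hasFDerivAt_coeff_prod_X_sub_C {ι E : Type*} [DecidableEq ι] [NormedAddCommGroup E]
    [NormedSpace ℝ E] (P : ι → E →L[ℝ] ℂ) (v : E) (s : Finset ι) (k : ℕ) :
    HasFDerivAt (fun v => (∏ j ∈ s, (X - C (P j v))).coeff k)
      (∑ j ∈ s, (-(∏ i ∈ s.erase j, (X - C (P i v))).coeff k) • P j) v := by
  induction s using Finset.induction_on generalizing k with
  | empty => simpa using hasFDerivAt_const _ _
  | insert a s ha ih =>
    have herase : ∀ j ∈ s, ∏ i ∈ (insert a s).erase j, (X - C (P i v)) =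
        (X - C (P a v)) * ∏ i ∈ s.erase j, (X - C (P i v)) := fun j hj => by
      rw [Finset.erase_insert_of_ne (fun h : a = j => ha (h ▸ hj)), Finset.prod_insert (by simp [ha])]
    rw [Finset.sum_insert ha, Finset.erase_insert ha]
    simp only [Finset.prod_insert ha]
    rw [Finset.sum_congr rfl fun j hj => by rw [herase j hj]]
    have hP : HasFDerivAt (fun v => P a v) (P a) v := (P a).hasFDerivAt
    cases k with
    | zero =>
      simp only [mul_coeff_zero, coeff_sub, coeff_X_zero, coeff_C_zero, zero_sub]
      have h := (hP.neg).mul (ih 0)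
      refine h.congr_fderiv ?_
      ext w
      simp only [add_apply, smul_apply,
        sum_apply, neg_apply, smul_eq_mul,
        Finset.mul_sum]
      rw [add_comm, Pi.neg_apply]
      congr 1
      · ring
      · exact Finset.sum_congr rfl fun j _ => by ring
    | succ k =>
      simp only [coeff_X_sub_C_mul]
      have h := (ih k).sub (hP.mul (ih (k + 1)))
      refine h.congr_fderiv ?_
      ext w
      simp only [add_apply, smul_apply,
        sum_apply, sub_apply, smul_eq_mul,
        Finset.mul_sum]
      rw [sub_add_eq_sub_sub, ← Finset.sum_sub_distrib, sub_eq_neg_add]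
      congr 1
      · ring
      · exact Finset.sum_congr rfl fun j _ => by ring

/-- The Jacobian matrix of the coefficients of `∏ (X - p_j)`. -/
def coeffJacobian {d : ℕ} (p : Fin d → ℂ) : Matrix (Fin d) (Fin d) ℂ :=
  Matrix.of fun i j => -(∏ k ∈ Finset.univ.erase j, (X - C (p k))).coeff (i : ℕ)

/-- Column j of the Jacobian lists the coefficients of a polynomial vanishing at every root except
the j-th; multiplying by the Vandermonde matrix evaluates it at all roots. -/
lemma vandermonde_mul_coeffJacobian {d : ℕ} (p : Fin d → ℂ) :
    Matrix.vandermonde p * coeffJacobian p =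
      Matrix.diagonal fun j => -∏ k ∈ Finset.univ.erase j, (p j - p k) := by
  ext l j
  have hdeg : (∏ k ∈ Finset.univ.erase j, (X - C (p k))).natDegree < d := by
    rw [natDegree_prod_of_monic _ _ fun k _ => monic_X_sub_C _]
    simp only [natDegree_X_sub_C, Finset.sum_const, smul_eq_mul, mul_one,
      Finset.card_erase_of_mem (Finset.mem_univ j), Finset.card_univ, Fintype.card_fin]
    have := j.pos
    omega
  have h : (Matrix.vandermonde p * coeffJacobian p) l j =
      -(∏ k ∈ Finset.univ.erase j, (X - C (p k))).eval (p l) := by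
    refine Matrix.mul_apply.trans ?_
    rw [eval_eq_sum_range' hdeg, Finset.sum_range, ← Finset.sum_neg_distrib]
    refine Finset.sum_congr rfl fun i _ => ?_
    rw [Matrix.vandermonde_apply, coeffJacobian, Matrix.of_apply]
    ring
  rw [h, eval_prod]
  simp only [eval_sub, eval_X, eval_C]
  by_cases hlj : l = j
  · subst hlj; simp
  · rw [Matrix.diagonal_apply_ne _ hlj, Finset.prod_eq_zero (i := l) (by simp [hlj]) (by simp),
      neg_zero]

/-- For distinct roots, the diagonal matrix above has determinant of absolute value |Δ|², and one
factor |Δ| cancels. For a repeated root two columns of the Jacobian coincide and both sides vanish.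
-/
lemma norm_det_coeffJacobian {d : ℕ} (p : Fin d → ℂ) :
    ‖(coeffJacobian p).det‖ = ‖(Matrix.vandermonde p).det‖ := by
  by_cases hp : Function.Injective p
  · have hV : ‖(Matrix.vandermonde p).det‖ ≠ 0 :=
      norm_ne_zero_iff.2 (Matrix.det_vandermonde_ne_zero_iff.2 hp)
    have h := congrArg (fun M => ‖Matrix.det M‖) (vandermonde_mul_coeffJacobian p)
    simp only [Matrix.det_mul, Matrix.det_diagonal, norm_mul, norm_prod, norm_neg] at h
    refine mul_left_cancel₀ hV (h.trans ?_)
    have h2 := Finset.prod_prod_Ioi_mul_eq_prod_prod_off_diag fun i j : Fin d => ‖p j - p i‖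
    simp only [Finset.prod_mul_distrib] at h2
    have h3 : ∀ i : Fin d, Finset.univ.erase i = {i}ᶜ := fun i => by
      ext; simp
    simp only [h3]
    rw [Matrix.det_vandermonde, norm_prod]
    simp only [norm_prod]
    calc ∏ i, ∏ j ∈ ({i} : Finset (Fin d))ᶜ, ‖p i - p j‖
        = _ := h2.symm
      _ = _ := by
        congr 1
        exact Finset.prod_congr rfl fun i _ => Finset.prod_congr rfl fun j _ => norm_sub_rev _ _
  · have hV := mt Matrix.det_vandermonde_ne_zero_iff.1 hp
    rw [not_not] at hV
    rw [hV]
    simp only [Function.Injective, not_forall] at hp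
    obtain ⟨i, j, hij, hne⟩ := hp
    rw [Matrix.det_zero_of_column_eq hne]
    intro k
    simp only [coeffJacobian, Matrix.of_apply]
    rw [← Finset.mul_prod_erase (Finset.univ.erase i) _ (a := j) (by simp [Ne.symm hne]),
      ← Finset.mul_prod_erase (Finset.univ.erase j) _ (a := i) (by simp [hne]), hij,
      Finset.erase_right_comm]

/-- The volume of a set of real polynomials parametrized by their roots, the roots being linear
functions of real parameters. -/
theorem volume_image_coeff {d : ℕ} (L : Matrix (Fin d) (Fin d) ℂ)
    (f : (Fin d → ℝ) → (Fin d → ℝ))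
    (hf : ∀ v i, ((f v i : ℝ) : ℂ) =
      (∏ j, (X - C (L.mulVec (fun k => (v k : ℂ)) j))).coeff (d - 1 - (i : ℕ)))
    {S : Set (Fin d → ℝ)} (hS : MeasurableSet S) (hinj : Set.InjOn f S) :
    volume (f '' S) = ∫⁻ v in S, ENNReal.ofReal
      (‖(Matrix.vandermonde (L.mulVec fun k => (v k : ℂ))).det‖ * ‖L.det‖) := by
  classical
  let P : Fin d → (Fin d → ℝ) →L[ℝ] ℂ := fun j =>
    ∑ k, L j k • (Complex.ofRealCLM.comp (ContinuousLinearMap.proj k))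
  have hP : ∀ j v, P j v = L.mulVec (fun k => (v k : ℂ)) j := fun j v => by
    simp [P, Matrix.mulVec, dotProduct]
  let D : (Fin d → ℝ) → Fin d → (Fin d → ℝ) →L[ℝ] ℂ := fun v i =>
    ∑ j, (-(∏ k ∈ Finset.univ.erase j, (X - C (P k v))).coeff (d - 1 - (i : ℕ))) • P j
  have hD : ∀ v i, HasFDerivAt (fun v => ((f v i : ℝ) : ℂ)) (D v i) v := fun v i => by
    simp only [hf, ← hP]
    exact hasFDerivAt_coeff_prod_X_sub_C P v Finset.univ (d - 1 - (i : ℕ))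
  have hre : ∀ v i, HasFDerivAt (fun v => f v i) (Complex.reCLM.comp (D v i)) v := fun v i => by
    have := (Complex.reCLM.hasFDerivAt (x := ((f v i : ℝ) : ℂ))).comp v (hD v i)
    exact this
  -- The coefficients are real-valued, so by uniqueness of derivatives their complex-valued
  -- derivative is real too.
  have hreal : ∀ v i w, (((D v i w).re : ℝ) : ℂ) = D v i w := fun v i w => by
    have h1 := (Complex.ofRealCLM.hasFDerivAt (x := f v i)).comp v (hre v i)
    have h2 := h1.unique (hD v i)
    exact congrArg (fun T : (Fin d → ℝ) →L[ℝ] ℂ => T w) h2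
  let f' : (Fin d → ℝ) → (Fin d → ℝ) →L[ℝ] (Fin d → ℝ) := fun v =>
    ContinuousLinearMap.pi fun i => Complex.reCLM.comp (D v i)
  have hf' : ∀ v, HasFDerivAt f (f' v) v := fun v => hasFDerivAt_pi.2 (hre v)
  have hdet : ∀ v, |(f' v).det| =
      ‖(Matrix.vandermonde (L.mulVec fun k => (v k : ℂ))).det‖ * ‖L.det‖ := by
    intro v
    have h1 : (f' v).det = (LinearMap.toMatrix' (f' v : (Fin d → ℝ) →ₗ[ℝ] (Fin d → ℝ))).det :=
      (LinearMap.det_toMatrix' _).symm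
    -- Chain rule through the linear map from parameters to roots. Rows are reversed because
    -- coordinate i is the coefficient of degree d - 1 - i.
    have h2 : (LinearMap.toMatrix' (f' v : (Fin d → ℝ) →ₗ[ℝ] (Fin d → ℝ))).map Complex.ofRealHom =
        (coeffJacobian (L.mulVec fun k => (v k : ℂ)) * L).submatrix Fin.revPerm id := by
      ext i k
      rw [Matrix.map_apply, LinearMap.toMatrix'_apply]
      refine (hreal v i _).trans ?_
      rw [Matrix.submatrix_apply, Matrix.mul_apply]
      simp only [D, sum_apply, smul_apply, smul_eq_mul, hP]
      refine Finset.sum_congr rfl fun j _ => ?_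
      have hrev : ((Fin.revPerm i : Fin d) : ℕ) = d - 1 - (i : ℕ) := by
        simp only [Fin.revPerm_apply, Fin.val_rev]
        omega
      rw [coeffJacobian, Matrix.of_apply, hrev]
      congr 1
      simp [Matrix.mulVec, dotProduct, Pi.single_apply, apply_ite Complex.ofReal]
    have h3 : ((f' v).det : ℂ) = ((Equiv.Perm.sign (Fin.revPerm : Equiv.Perm (Fin d)) : ℤ) : ℂ) *
        ((coeffJacobian (L.mulVec fun k => (v k : ℂ))).det * L.det) := by
      rw [h1, ← Matrix.det_mul, ← Matrix.det_permute, ← h2]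
      exact Complex.ofRealHom.map_det _
    have h4 : ‖((f' v).det : ℂ)‖ = |(f' v).det| := by
      rw [Complex.norm_real, Real.norm_eq_abs]
    have h5 : ‖((Equiv.Perm.sign (Fin.revPerm : Equiv.Perm (Fin d)) : ℤ) : ℂ)‖ = 1 := by
      rcases Int.units_eq_one_or (Equiv.Perm.sign (Fin.revPerm : Equiv.Perm (Fin d))) with h | h <;>
        simp [h]
    rw [← h4, h3, norm_mul, norm_mul, h5, one_mul, norm_det_coeffJacobian]
  have h := lintegral_image_eq_lintegral_abs_det_fderiv_mul volume hS
    (fun v _ => (hf' v).hasFDerivWithinAt) hinj (fun _ => 1)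
  simp only [lintegral_one, Measure.restrict_apply MeasurableSet.univ, Set.univ_inter, mul_one] at h
  rw [h]
  simp only [hdet]

/-! ### Parametrization of the polynomials by their roots -/

/-- The coefficient vector of a monic polynomial of degree `d`. -/
def coeffVec (d : ℕ) (p : ℝ[X]) : Fin d → ℝ := fun i => p.coeff (d - 1 - (i : ℕ))

lemma coeffPoly_eq_sum_range {d : ℕ} (a : Fin d → ℝ) :
    coeffPoly a = X ^ d + ∑ i : Fin d, C (a i.rev) * X ^ (i : ℕ) := by
  rw [coeffPoly, ← Equiv.sum_comp Fin.revPerm]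
  congr 1
  refine Finset.sum_congr rfl fun i _ => ?_
  rw [Fin.revPerm_apply, Fin.val_rev]
  congr 2
  omega

lemma coeffPoly_coeffVec {d : ℕ} {p : ℝ[X]} (hp : p.Monic) (hd : p.natDegree = d) :
    coeffPoly (coeffVec d p) = p := by
  conv_rhs => rw [hp.as_sum, hd, Finset.sum_range]
  rw [coeffPoly_eq_sum_range]
  congr 1
  refine Finset.sum_congr rfl fun i _ => ?_
  rw [coeffVec, Fin.val_rev]
  congr 3
  omega

lemma degree_coeff_sum_lt {d : ℕ} (a : Fin d → ℝ) :
    (∑ i : Fin d, C (a i.rev) * X ^ (i : ℕ)).degree < (d : WithBot ℕ) :=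
  degree_sum_fin_lt _

lemma monic_coeffPoly {d : ℕ} (a : Fin d → ℝ) : (coeffPoly a).Monic := by
  rw [coeffPoly_eq_sum_range]
  exact monic_X_pow_add (degree_coeff_sum_lt a)

lemma natDegree_coeffPoly {d : ℕ} (a : Fin d → ℝ) : (coeffPoly a).natDegree = d := by
  rw [coeffPoly_eq_sum_range]
  refine natDegree_eq_of_degree_eq_some ?_
  rw [degree_add_eq_left_of_degree_lt, degree_X_pow]
  rw [degree_X_pow]
  exact degree_coeff_sum_lt a

lemma coeffVec_coeffPoly {d : ℕ} (a : Fin d → ℝ) : coeffVec d (coeffPoly a) = a := by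
  funext i
  rw [coeffVec, coeffPoly, coeff_add, coeff_X_pow, if_neg (by have := i.pos; omega), zero_add,
    finsetSum_coeff, Finset.sum_eq_single i]
  · simp
  · intro j _ hj
    rw [coeff_C_mul, coeff_X_pow, if_neg, mul_zero]
    intro h
    exact hj (Fin.ext (by omega))
  · simp

lemma coeffVec_injOn {d : ℕ} {p q : ℝ[X]} (hp : p.Monic) (hd : p.natDegree = d)
    (hq : q.Monic) (hd' : q.natDegree = d) (h : coeffVec d p = coeffVec d q) : p = q := by
  rw [← coeffPoly_coeffVec hp hd, h, coeffPoly_coeffVec hq hd']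

/-- The monic polynomial with the given real roots. -/
def rootPoly {m : ℕ} (x : Fin m → ℝ) : ℝ[X] := ∏ i, (X - C (x i))

lemma monic_rootPoly {m : ℕ} (x : Fin m → ℝ) : (rootPoly x).Monic :=
  monic_prod_of_monic _ _ fun _ _ => monic_X_sub_C _

lemma natDegree_rootPoly {m : ℕ} (x : Fin m → ℝ) : (rootPoly x).natDegree = m := by
  rw [rootPoly, natDegree_prod_of_monic _ _ fun _ _ => monic_X_sub_C _]
  simp

lemma rootPoly_eq {m : ℕ} (x : Fin m → ℝ) :
    rootPoly x = ((Finset.univ.val.map x).map fun r => X - C r).prod := by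
  rw [Multiset.map_map]
  rfl

lemma map_rootPoly {m : ℕ} (x : Fin m → ℝ) :
    (rootPoly x).map (algebraMap ℝ ℂ) = ∏ i, (X - C (x i : ℂ)) := by
  simp [rootPoly, Polynomial.map_prod]

lemma aroots_rootPoly {m : ℕ} (x : Fin m → ℝ) :
    (rootPoly x).aroots ℂ = (Finset.univ.val.map x).map ((↑) : ℝ → ℂ) := by
  rw [aroots, map_rootPoly, Multiset.map_map, ← roots_multiset_prod_X_sub_C
    (Finset.univ.val.map (((↑) : ℝ → ℂ) ∘ x)), Multiset.map_map]
  rfl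

/-- The real quadratic polynomial with roots `a ± b i`. -/
def quadPoly (a b : ℝ) : ℝ[X] := (X - C a) ^ 2 + C (b ^ 2)

lemma natDegree_quadPoly (a b : ℝ) : (quadPoly a b).natDegree = 2 := by
  rw [quadPoly, natDegree_add_C, natDegree_pow, natDegree_X_sub_C]

lemma monic_quadPoly (a b : ℝ) : (quadPoly a b).Monic := by
  refine ((monic_X_sub_C a).pow 2).add_of_left (lt_of_le_of_lt degree_C_le ?_)
  rw [degree_pow, degree_X_sub_C]
  norm_num

lemma map_quadPoly (a b : ℝ) : (quadPoly a b).map (algebraMap ℝ ℂ) =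
    (X - C (a + b * Complex.I : ℂ)) * (X - C (a - b * Complex.I : ℂ)) := by
  have hI : (C Complex.I : ℂ[X]) ^ 2 = -1 := by
    rw [← C_pow, Complex.I_sq]; simp
  simp only [quadPoly, Polynomial.map_add, Polynomial.map_pow, Polynomial.map_sub, map_X, map_C,
    Complex.coe_algebraMap, C_add, C_sub, C_mul, C_pow]
  linear_combination (C (b : ℂ)) ^ 2 * hI

lemma aroots_quadPoly (a b : ℝ) :
    (quadPoly a b).aroots ℂ = {(a + b * Complex.I : ℂ), (a - b * Complex.I : ℂ)} := by
  rw [aroots, map_quadPoly, roots_mul (mul_ne_zero (X_sub_C_ne_zero _) (X_sub_C_ne_zero _)),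
    roots_X_sub_C, roots_X_sub_C]
  rfl

lemma numConjPairs_mul {p q : ℝ[X]} (h : p * q ≠ 0) :
    numConjPairs (p * q) = numConjPairs p + numConjPairs q := by
  rw [numConjPairs, aroots_mul h, Multiset.filter_add, Multiset.card_add]
  rfl

lemma filter_im_pos_map_ofReal (s : Multiset ℝ) :
    (s.map ((↑) : ℝ → ℂ)).filter (fun z => 0 < z.im) = 0 := by
  rw [Multiset.filter_eq_nil]
  intro z hz
  obtain ⟨r, -, rfl⟩ := Multiset.mem_map.1 hz
  simp

lemma numConjPairs_rootPoly {m : ℕ} (x : Fin m → ℝ) : numConjPairs (rootPoly x) = 0 := by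
  rw [numConjPairs, aroots_rootPoly, filter_im_pos_map_ofReal, Multiset.card_zero]

lemma filter_im_pos_quadPoly {a b : ℝ} (hb : 0 < b) :
    ((quadPoly a b).aroots ℂ).filter (fun z => 0 < z.im) = {(a + b * Complex.I : ℂ)} := by
  rw [aroots_quadPoly, Multiset.insert_eq_cons, Multiset.filter_cons_of_pos _ (by simpa using hb),
    Multiset.filter_singleton, if_neg (by simpa using hb.le)]
  rfl

lemma numConjPairs_quadPoly {a b : ℝ} (hb : 0 < b) : numConjPairs (quadPoly a b) = 1 := by
  rw [numConjPairs, filter_im_pos_quadPoly hb, Multiset.card_singleton]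

lemma eq_of_monotone_of_map_eq {m : ℕ} {x y : Fin m → ℝ} (hx : Monotone x) (hy : Monotone y)
    (h : Finset.univ.val.map x = Finset.univ.val.map y) : x = y := by
  rw [Fin.univ_val_map, Fin.univ_val_map, Multiset.coe_eq_coe] at h
  exact List.ofFn_injective (List.Perm.eq_of_sortedLE hx.sortedLE_ofFn hy.sortedLE_ofFn h)

lemma exists_monotone_map_eq {m : ℕ} (s : Multiset ℝ) (hs : Multiset.card s = m) :
    ∃ x : Fin m → ℝ, Monotone x ∧ Finset.univ.val.map x = s := by
  have hl : (s.sort (· ≤ ·)).length = m := by rw [Multiset.length_sort, hs]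
  subst hl
  refine ⟨(s.sort (· ≤ ·)).get, ((s.pairwise_sort (· ≤ ·)).sortedLE).monotone_get, ?_⟩
  rw [Fin.univ_val_map, List.ofFn_get, Multiset.sort_eq]

/-- Roots of a real polynomial are closed under conjugation, so having none in the upper half plane
forces all of them to be real. -/
lemma exists_eq_rootPoly {m : ℕ} {p : ℝ[X]} (hp : p.Monic) (hd : p.natDegree = m)
    (h : numConjPairs p = 0) : ∃ x : Fin m → ℝ, Monotone x ∧ p = rootPoly x := by
  have him : ∀ z ∈ p.aroots ℂ, z.im ≤ 0 := by
    rw [numConjPairs, Multiset.card_eq_zero, Multiset.filter_eq_nil] at h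
    exact fun z hz => not_lt.1 (h z hz)
  have hreal : ∀ z ∈ p.aroots ℂ, ((z.re : ℝ) : ℂ) = z := by
    intro z hz
    have hz' : (starRingEnd ℂ) z ∈ p.aroots ℂ := by
      rw [mem_aroots] at hz ⊢
      refine ⟨hz.1, ?_⟩
      have := Polynomial.aeval_conj p z
      rw [this, hz.2, map_zero]
    have h1 := him z hz
    have h2 := him _ hz'
    rw [Complex.conj_im] at h2
    exact Complex.ext rfl (by simpa using (by linarith : (0 : ℝ) = z.im))
  have hsplit : p.map (algebraMap ℝ ℂ) = ((p.aroots ℂ).map fun z => X - C z).prod :=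
    (IsAlgClosed.splits _).eq_prod_roots_of_monic (hp.map _)
  have hcard : Multiset.card (p.aroots ℂ) = m := by
    have := congrArg natDegree hsplit
    rw [natDegree_multiset_prod_X_sub_C_eq_card, natDegree_map, hd] at this
    exact this.symm
  obtain ⟨x, hx, hxs⟩ := exists_monotone_map_eq (m := m) ((p.aroots ℂ).map Complex.re)
    (by rw [Multiset.card_map, hcard])
  refine ⟨x, hx, map_injective (algebraMap ℝ ℂ) (algebraMap ℝ ℂ).injective ?_⟩
  rw [hsplit, rootPoly_eq, hxs, Polynomial.map_multiset_prod, Multiset.map_map, Multiset.map_map]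
  congr 1
  refine Multiset.map_congr rfl fun z hz => ?_
  simp [hreal z hz]

/-- The ordered real root vectors in `(-1, 1)`. -/
def orderedRoots (m : ℕ) : Set (Fin m → ℝ) := {x | Monotone x ∧ ∀ i, x i ∈ Set.Ioo (-1 : ℝ) 1}

lemma norm_lt_one_aroots_rootPoly {m : ℕ} (x : Fin m → ℝ) :
    (∀ z ∈ (rootPoly x).aroots ℂ, ‖z‖ < 1) ↔ ∀ i, x i ∈ Set.Ioo (-1 : ℝ) 1 := by
  rw [aroots_rootPoly]
  simp [abs_lt]

lemma contractiveSetPairs_zero_eq_image (d : ℕ) :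
    contractiveSetPairs d 0 = (fun x => coeffVec d (rootPoly x)) '' orderedRoots d := by
  ext a
  constructor
  · rintro ⟨ha, hc⟩
    obtain ⟨x, hx, hpx⟩ := exists_eq_rootPoly (monic_coeffPoly a) (natDegree_coeffPoly a) hc
    refine ⟨x, ⟨hx, ?_⟩, ?_⟩
    · rw [← norm_lt_one_aroots_rootPoly, ← hpx]
      exact ha
    · simp only [← hpx, coeffVec_coeffPoly]
  · rintro ⟨x, ⟨-, hx⟩, rfl⟩
    have h := coeffPoly_coeffVec (monic_rootPoly x) (natDegree_rootPoly x)
    refine ⟨?_, ?_⟩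
    · change ∀ z ∈ (coeffPoly (coeffVec d (rootPoly x))).aroots ℂ, ‖z‖ < 1
      rw [h, norm_lt_one_aroots_rootPoly]
      exact hx
    · simp only [h, numConjPairs_rootPoly]

/-- A sorted vector is determined by its multiset of entries. Sorting is weak, so repeated roots are
included and no null set has to be discarded. -/
lemma injOn_coeffVec_rootPoly (d : ℕ) :
    Set.InjOn (fun x => coeffVec d (rootPoly x)) (orderedRoots d) := by
  intro x hx y hy h
  have h' := coeffVec_injOn (monic_rootPoly x) (natDegree_rootPoly x) (monic_rootPoly y)
    (natDegree_rootPoly y) h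
  refine eq_of_monotone_of_map_eq hx.1 hy.1 ?_
  refine Multiset.map_injective Complex.ofReal_injective ?_
  rw [← aroots_rootPoly, ← aroots_rootPoly, h']

/-- The tail of a vector, without its first two entries. -/
def tail₂ {n : ℕ} (v : Fin (n + 2) → ℝ) : Fin n → ℝ := fun i => v i.succ.succ

/-- The parameters of the polynomials with exactly one pair of conjugate roots: real and imaginary
part of the root in the upper half plane, and the ordered real roots. -/
def onePairParams (n : ℕ) : Set (Fin (n + 2) → ℝ) :=
  {v | (v 0 ^ 2 + v 1 ^ 2 < 1 ∧ 0 < v 1) ∧ tail₂ v ∈ orderedRoots n}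

/-- The polynomial with the given parameters. -/
def onePairPoly {n : ℕ} (v : Fin (n + 2) → ℝ) : ℝ[X] := quadPoly (v 0) (v 1) * rootPoly (tail₂ v)

lemma monic_onePairPoly {n : ℕ} (v : Fin (n + 2) → ℝ) : (onePairPoly v).Monic :=
  (monic_quadPoly _ _).mul (monic_rootPoly _)

lemma natDegree_onePairPoly {n : ℕ} (v : Fin (n + 2) → ℝ) : (onePairPoly v).natDegree = n + 2 := by
  rw [onePairPoly, (monic_quadPoly _ _).natDegree_mul (monic_rootPoly _), natDegree_quadPoly,
    natDegree_rootPoly, add_comm]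

lemma aroots_onePairPoly {n : ℕ} (v : Fin (n + 2) → ℝ) : (onePairPoly v).aroots ℂ =
    (quadPoly (v 0) (v 1)).aroots ℂ + (rootPoly (tail₂ v)).aroots ℂ :=
  aroots_mul (monic_onePairPoly v).ne_zero

lemma norm_lt_one_aroots_quadPoly (a b : ℝ) :
    (∀ z ∈ (quadPoly a b).aroots ℂ, ‖z‖ < 1) ↔ a ^ 2 + b ^ 2 < 1 := by
  have h1 : ‖(a + b * Complex.I : ℂ)‖ < 1 ↔ a ^ 2 + b ^ 2 < 1 := by
    rw [Complex.norm_add_mul_I, Real.sqrt_lt' one_pos, one_pow]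
  have h2 : ‖(a - b * Complex.I : ℂ)‖ < 1 ↔ a ^ 2 + b ^ 2 < 1 := by
    have : (a - b * Complex.I : ℂ) = a + ((-b : ℝ) : ℂ) * Complex.I := by push_cast; ring
    rw [this, Complex.norm_add_mul_I, Real.sqrt_lt' one_pos, one_pow, neg_sq]
  rw [aroots_quadPoly]
  simp [h1, h2]

/-- The single root in the upper half plane splits off a real quadratic factor, and additivity of
`numConjPairs` leaves a cofactor with only real roots. -/
lemma contractiveSetPairs_one_eq_image (n : ℕ) :
    contractiveSetPairs (n + 2) 1 = (fun v => coeffVec (n + 2) (onePairPoly v)) ''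
      onePairParams n := by
  ext a
  constructor
  · rintro ⟨ha, hc⟩
    change ∀ z ∈ (coeffPoly a).aroots ℂ, ‖z‖ < 1 at ha
    obtain ⟨z, hz⟩ := Multiset.card_eq_one.1 hc
    have hz' : z ∈ ((coeffPoly a).aroots ℂ).filter fun z => 0 < z.im := by
      rw [hz]; exact Multiset.mem_singleton_self z
    obtain ⟨hzr, hzi⟩ := Multiset.mem_filter.1 hz'
    obtain ⟨g, hg⟩ := Polynomial.quadratic_dvd_of_aeval_eq_zero_im_ne_zero (coeffPoly a)
      (mem_aroots.1 hzr).2 hzi.ne'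
    have hq : (X ^ 2 - C (2 * z.re) * X + C (‖z‖ ^ 2) : ℝ[X]) = quadPoly z.re z.im := by
      rw [quadPoly, Complex.sq_norm, Complex.normSq_apply]
      simp only [C_mul, C_add, C_pow, C_ofNat]
      ring
    rw [hq] at hg
    have hgm : g.Monic := (monic_quadPoly _ _).of_mul_monic_left (hg ▸ monic_coeffPoly a)
    have hgd : g.natDegree = n := by
      have := natDegree_coeffPoly a
      rw [hg, (monic_quadPoly _ _).natDegree_mul hgm, natDegree_quadPoly] at this
      omega
    have hgc : numConjPairs g = 0 := by
      have h1 := numConjPairs_mul (p := quadPoly z.re z.im) (q := g)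
        ((monic_quadPoly _ _).mul hgm).ne_zero
      rw [← hg, hc, numConjPairs_quadPoly hzi] at h1
      omega
    obtain ⟨x, hx, hgx⟩ := exists_eq_rootPoly hgm hgd hgc
    have htail : tail₂ (Fin.cons z.re (Fin.cons z.im x) : Fin (n + 2) → ℝ) = x := rfl
    have hpoly : onePairPoly (Fin.cons z.re (Fin.cons z.im x) : Fin (n + 2) → ℝ) =
        coeffPoly a := by
      rw [hg, hgx]; rfl
    have hroots := aroots_onePairPoly (Fin.cons z.re (Fin.cons z.im x) : Fin (n + 2) → ℝ)
    rw [hpoly] at hroots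
    rw [hroots] at ha
    refine ⟨Fin.cons z.re (Fin.cons z.im x), ⟨⟨?_, hzi⟩, hx, ?_⟩, ?_⟩
    · rw [← norm_lt_one_aroots_quadPoly]
      exact fun w hw => ha w (Multiset.mem_add.2 (Or.inl hw))
    · rw [← norm_lt_one_aroots_rootPoly]
      exact fun w hw => ha w (Multiset.mem_add.2 (Or.inr hw))
    · simp only [hpoly, coeffVec_coeffPoly]
  · rintro ⟨v, ⟨⟨h1, h2⟩, -, hx⟩, rfl⟩
    have h := coeffPoly_coeffVec (monic_onePairPoly v) (natDegree_onePairPoly v)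
    refine ⟨?_, ?_⟩
    · change ∀ z ∈ (coeffPoly (coeffVec (n + 2) (onePairPoly v))).aroots ℂ, ‖z‖ < 1
      rw [h, aroots_onePairPoly]
      intro z hz
      rcases Multiset.mem_add.1 hz with hz | hz
      · exact (norm_lt_one_aroots_quadPoly _ _).2 h1 z hz
      · exact (norm_lt_one_aroots_rootPoly _).2 hx z hz
    · simp only [h]
      rw [onePairPoly, numConjPairs_mul (monic_onePairPoly v).ne_zero, numConjPairs_quadPoly h2,
        numConjPairs_rootPoly]

lemma injOn_coeffVec_onePairPoly (n : ℕ) :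
    Set.InjOn (fun v => coeffVec (n + 2) (onePairPoly v)) (onePairParams n) := by
  intro v hv w hw h
  have h' := coeffVec_injOn (monic_onePairPoly v) (natDegree_onePairPoly v) (monic_onePairPoly w)
    (natDegree_onePairPoly w) h
  have hr : (onePairPoly v).aroots ℂ = (onePairPoly w).aroots ℂ := by rw [h']
  rw [aroots_onePairPoly, aroots_onePairPoly] at hr
  have hf := congrArg (Multiset.filter fun z : ℂ => 0 < z.im) hr
  rw [Multiset.filter_add, Multiset.filter_add, filter_im_pos_quadPoly hv.1.2,
    filter_im_pos_quadPoly hw.1.2, aroots_rootPoly, aroots_rootPoly, filter_im_pos_map_ofReal,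
    filter_im_pos_map_ofReal, add_zero, add_zero, Multiset.singleton_inj] at hf
  have h0 : v 0 = w 0 := by simpa using congrArg Complex.re hf
  have h1 : v 1 = w 1 := by simpa using congrArg Complex.im hf
  rw [h0, h1, add_right_inj, aroots_rootPoly, aroots_rootPoly] at hr
  have ht := eq_of_monotone_of_map_eq hv.2.1 hw.2.1
    (Multiset.map_injective Complex.ofReal_injective hr)
  funext i
  refine Fin.cases h0 (fun i => Fin.cases h1 (fun i => ?_) i) i
  exact congrFun ht i

/-! ### Volume of the totally real polynomials -/

lemma cubeMeasure_eq_Ioo (n : ℕ) :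
    cubeMeasure n = volume.restrict (Set.univ.pi fun _ => Set.Ioo (-1) 1) := by
  rw [cubeMeasure, volume_pi, Measure.restrict_pi_pi]
  congr 1
  funext i
  exact (Measure.restrict_congr_set Ioo_ae_eq_Icc).symm

lemma measurableSet_orderedRoots (n : ℕ) : MeasurableSet (orderedRoots n) := by
  have h : orderedRoots n = {x : Fin n → ℝ | Monotone x} ∩ Set.univ.pi fun _ => Set.Ioo (-1) 1 := by
    ext x
    simp only [orderedRoots, Set.mem_inter_iff, Set.mem_pi, Set.mem_univ, forall_const]
    rfl
  rw [h]
  exact isClosed_monotone.measurableSet.inter (MeasurableSet.univ_pi fun _ => measurableSet_Ioo)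

lemma lintegral_perm {n : ℕ} (σ : Equiv.Perm (Fin n)) (f : (Fin n → ℝ) → ENNReal) :
    ∫⁻ x, f (x ∘ σ) = ∫⁻ x, f x := by
  have h := volume_measurePreserving_piCongrLeft (fun _ : Fin n => ℝ) σ.symm
  rw [← h.lintegral_comp_emb (MeasurableEquiv.measurableEmbedding _) f]
  congr 1
  funext x
  congr 1
  funext i
  have h3 := Equiv.piCongrLeft_apply_apply (fun _ => ℝ) σ.symm x (σ i)
  rw [Equiv.symm_apply_apply] at h3
  exact h3.symm

/-- The integral of a symmetric function over the cube, in terms of the ordered vectors. -/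
lemma factorial_mul_lintegral_orderedRoots {n : ℕ} (g : (Fin n → ℝ) → ENNReal)
    (hg : Measurable g) (hsymm : ∀ (σ : Equiv.Perm (Fin n)) x, g (x ∘ σ) = g x) :
    (n.factorial : ENNReal) * ∫⁻ x in orderedRoots n, g x = ∫⁻ x, g x ∂cubeMeasure n := by
  classical
  have hS := measurableSet_orderedRoots n
  have hm : Measurable ((orderedRoots n).indicator g) := hg.indicator hS
  have h1 : (n.factorial : ENNReal) * ∫⁻ x in orderedRoots n, g x =
      ∑ σ : Equiv.Perm (Fin n), ∫⁻ x, (orderedRoots n).indicator g (x ∘ σ) := by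
    simp only [lintegral_perm]
    rw [lintegral_indicator hS, Finset.sum_const, Finset.card_univ, Fintype.card_perm,
      Fintype.card_fin, nsmul_eq_mul]
  rw [h1, ← lintegral_finsetSum, cubeMeasure_eq_Ioo,
    ← lintegral_indicator (MeasurableSet.univ_pi fun _ => measurableSet_Ioo)]
  · have hinj : ∀ᵐ x ∂cubeMeasure n, Function.Injective x := ae_injective_cube n
    rw [cubeMeasure_eq_Ioo, ae_restrict_iff' (MeasurableSet.univ_pi fun _ => measurableSet_Ioo)]
      at hinj
    refine lintegral_congr_ae ?_
    filter_upwards [hinj] with x hx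
    by_cases hxm : x ∈ Set.univ.pi fun _ : Fin n => Set.Ioo (-1 : ℝ) 1
    -- For distinct coordinates, exactly one permutation sorts x, so one summand survives.
    · rw [Set.indicator_of_mem hxm, Finset.sum_eq_single (Tuple.sort x)]
      · rw [Set.indicator_of_mem, hsymm]
        exact ⟨Tuple.monotone_sort x, fun i => hxm _ trivial⟩
      · intro σ _ hσ
        refine Set.indicator_of_notMem (fun h => hσ ?_) _
        have := Tuple.unique_monotone h.1 (Tuple.monotone_sort x)
        exact Equiv.ext fun i => hx hxm (congrFun this i)
      · simp
    · rw [Set.indicator_of_notMem hxm]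
      refine Finset.sum_eq_zero fun σ _ => Set.indicator_of_notMem (fun h => hxm ?_) _
      intro i _
      have := h.2 (σ.symm i)
      simpa using this
  · intro σ _
    exact hm.comp (measurable_pi_lambda _ fun i => measurable_pi_apply (σ i))

lemma abs_det_vandermonde_comp {n : ℕ} (σ : Equiv.Perm (Fin n)) (x : Fin n → ℝ) :
    |(Matrix.vandermonde (x ∘ σ)).det| = |(Matrix.vandermonde x).det| := by
  rw [vandermonde_comp, Matrix.det_permute, abs_mul]
  rcases Int.units_eq_one_or (Equiv.Perm.sign σ) with h | h <;> simp [h]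

lemma integrable_abs_vandermonde (n : ℕ) :
    Integrable (fun x => |(Matrix.vandermonde x).det|) (cubeMeasure n) := by
  have := integrable_cube (n := n) (s := fun _ => 1) measurable_const (by simp)
    (continuous_det_vandermonde n).abs
  simpa using this

lemma volume_contractiveSetPairs_zero (d : ℕ) :
    (d.factorial : ENNReal) * volume (contractiveSetPairs d 0) = ENNReal.ofReal (vandMass d) := by
  have h := volume_image_coeff (1 : Matrix (Fin d) (Fin d) ℂ)
    (fun x => coeffVec d (rootPoly x)) (fun v i => by
      rw [Matrix.one_mulVec, ← map_rootPoly, coeff_map]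
      rfl) (measurableSet_orderedRoots d) (injOn_coeffVec_rootPoly d)
  have hV : ∀ v : Fin d → ℝ, ‖(Matrix.vandermonde
      ((1 : Matrix (Fin d) (Fin d) ℂ).mulVec fun k => (v k : ℂ))).det‖ *
      ‖(1 : Matrix (Fin d) (Fin d) ℂ).det‖ = |(Matrix.vandermonde v).det| := fun v => by
    rw [Matrix.one_mulVec, Matrix.det_one, norm_one, mul_one, Matrix.det_vandermonde,
      Matrix.det_vandermonde, ← Real.norm_eq_abs, ← Complex.norm_real]
    push_cast
    rfl
  rw [contractiveSetPairs_zero_eq_image, h]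
  simp only [hV]
  rw [factorial_mul_lintegral_orderedRoots, vandMass,
    ofReal_integral_eq_lintegral_ofReal (integrable_abs_vandermonde d)
      (Filter.Eventually.of_forall fun _ => abs_nonneg _)]
  · exact (continuous_det_vandermonde d).abs.measurable.ennreal_ofReal
  · intro σ x
    rw [abs_det_vandermonde_comp]

lemma vandMass_pos (n : ℕ) : 0 < vandMass n := by
  rw [vandMass, integral_pos_iff_support_of_nonneg (fun _ => abs_nonneg _)
    (integrable_abs_vandermonde n)]
  have h : (Function.support fun x : Fin n → ℝ => |(Matrix.vandermonde x).det|) =ᵐ[cubeMeasure n]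
      Set.univ := by
    filter_upwards [ae_injective_cube n] with x hx
    refine propext ⟨fun _ => trivial, fun _ => ?_⟩
    exact abs_ne_zero.2 (Matrix.det_vandermonde_ne_zero_iff.2 hx)
  rw [measure_congr h, cubeMeasure, Measure.pi_univ]
  simpa using ENNReal.pow_pos (ENNReal.ofReal_pos.2 (by norm_num)) n

/-- The volume of the totally real contractive polynomials. -/
theorem contractiveVol_zero (d : ℕ) : volume (contractiveSetPairs d 0) ≠ ⊤ ∧
    d.factorial * contractiveVol d 0 = vandMass d := by
  have h := volume_contractiveSetPairs_zero d
  have hd : (d.factorial : ENNReal) ≠ 0 := by exact_mod_cast d.factorial_ne_zero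
  constructor
  · intro htop
    rw [htop, ENNReal.mul_top hd] at h
    exact ENNReal.ofReal_ne_top h.symm
  · have := congrArg ENNReal.toReal h
    rwa [ENNReal.toReal_mul, ENNReal.toReal_natCast, ENNReal.toReal_ofReal (vandMass_pos d).le]
      at this

/-! ### Volume of the polynomials with one conjugate pair -/

lemma lintegral_fin_succ {n : ℕ} (F : (Fin (n + 1) → ℝ) → ENNReal) (hF : Measurable F) :
    ∫⁻ v, F v = ∫⁻ a : ℝ, ∫⁻ x : Fin n → ℝ, F (Fin.cons a x) := by
  have h := (volume_preserving_piFinSuccAbove (fun _ : Fin (n + 1) => ℝ) 0).symm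
  rw [← h.lintegral_comp_emb (MeasurableEquiv.measurableEmbedding _) F, Measure.volume_eq_prod,
    lintegral_prod]
  · congr 1
    funext a
    congr 1
    funext x
    simp [MeasurableEquiv.piFinSuccAbove, Fin.insertNthEquiv]
  · exact (hF.comp (MeasurableEquiv.measurable _)).aemeasurable

/-- The change of coordinates from real parameters to roots, for one pair of conjugate roots. -/
def onePairMatrix (n : ℕ) : Matrix (Fin (n + 2)) (Fin (n + 2)) ℂ :=
  Matrix.of (Matrix.vecCons (Pi.single 0 1 + Pi.single 1 Complex.I)
    (Matrix.vecCons (Pi.single 0 1 - Pi.single 1 Complex.I)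
      fun i => Pi.single i.succ.succ 1))

lemma onePairMatrix_mulVec {n : ℕ} (v : Fin (n + 2) → ℝ) :
    (onePairMatrix n).mulVec (fun k => (v k : ℂ)) =
      Fin.cons (v 0 + v 1 * Complex.I : ℂ) (Fin.cons (v 0 - v 1 * Complex.I : ℂ)
        fun i => (tail₂ v i : ℂ)) := by
  funext i
  refine Fin.cases ?_ (fun i => Fin.cases ?_ (fun i => ?_) i) i
  · change (Pi.single 0 1 + Pi.single 1 Complex.I) ⬝ᵥ (fun k => (v k : ℂ)) = _
    rw [add_dotProduct]
    simp [mul_comm]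
  · change (Pi.single 0 1 - Pi.single 1 Complex.I) ⬝ᵥ (fun k => (v k : ℂ)) = _
    rw [sub_dotProduct]
    simp [mul_comm]
  · simp [onePairMatrix, Matrix.mulVec, tail₂]

/-- Apart from an identity block, the matrix is the block with rows (1, i) and (1, -i), of
determinant -2i. -/
lemma norm_det_onePairMatrix (n : ℕ) : ‖(onePairMatrix n).det‖ = 2 := by
  have h : (onePairMatrix n).det = detCons (Pi.single 0 1 + Pi.single 1 Complex.I)
      (Matrix.vecCons (Pi.single 0 1 - Pi.single 1 Complex.I)
      fun i => Pi.single i.succ.succ (1 : ℂ)) := rfl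
  have h1 : detCons (Pi.single (0 : Fin (n + 2)) (1 : ℂ)) (Matrix.vecCons (Pi.single 1 1)
      fun i : Fin n => Pi.single i.succ.succ (1 : ℂ)) = 1 := by
    rw [detCons, ← Matrix.det_one (n := Fin (n + 2))]
    congr 1
    ext i j
    rw [Matrix.one_apply]
    refine Fin.cases ?_ (fun i => Fin.cases ?_ (fun i => ?_) i) i
    · simp [Pi.single_apply, eq_comm]
    · simp [Pi.single_apply, eq_comm]
    · simp [Pi.single_apply, eq_comm]
  have h2 : detCons (Pi.single (1 : Fin (n + 2)) (1 : ℂ)) (Matrix.vecCons (Pi.single 0 1)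
      fun i : Fin n => Pi.single i.succ.succ (1 : ℂ)) = -1 := by
    rw [detCons_swap, h1]
  have h3 : ∀ a : Fin (n + 2), detCons (Pi.single a (1 : ℂ)) (Matrix.vecCons (Pi.single a 1)
      fun i : Fin n => Pi.single i.succ.succ (1 : ℂ)) = 0 := fun a =>
    Matrix.det_zero_of_row_eq (i := 0) (j := 1) (by simp) rfl
  have hadd : ∀ r s (A : Fin (n + 1) → Fin (n + 2) → ℂ),
      detCons (r + s) A = detCons r A + detCons s A := fun r s A => by
    simp only [detCons_eq_sum, ← Finset.sum_add_distrib, Pi.add_apply]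
    exact Finset.sum_congr rfl fun _ _ => by ring
  have hI : ∀ a (A : Fin (n + 1) → Fin (n + 2) → ℂ), ∀ c : ℂ, detCons (Pi.single a c) A =
      c * detCons (Pi.single a 1) A := fun a A c => by
    simp only [detCons_eq_sum, Finset.mul_sum]
    refine Finset.sum_congr rfl fun j _ => ?_
    by_cases hj : j = a
    · subst hj; simp; ring
    · simp [hj]
  have hsecond : ∀ a (A : Fin n → Fin (n + 2) → ℂ),
      detCons (Pi.single a 1) (Matrix.vecCons (Pi.single 0 1 - Pi.single 1 Complex.I) A) =
      detCons (Pi.single a 1) (Matrix.vecCons (Pi.single 0 1) A) -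
        Complex.I * detCons (Pi.single a 1) (Matrix.vecCons (Pi.single 1 1) A) := fun a A => by
    rw [detCons_swap, sub_eq_add_neg, ← Pi.single_neg, hadd, hI 1, detCons_swap (Pi.single 0 1),
      detCons_swap (Pi.single 1 1) (Pi.single a 1)]
    ring
  have : (onePairMatrix n).det = -2 * Complex.I := by
    rw [h, hadd, hI 1, hsecond, hsecond, h1, h2, h3, h3]
    ring
  rw [this]
  simp

lemma det_vandermonde_cons_cons {R : Type*} [CommRing R] {n : ℕ} (z w : R) (x : Fin n → R) :
    (Matrix.vandermonde (Fin.cons z (Fin.cons w x) : Fin (n + 2) → R)).det =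
      (w - z) * (∏ i, (x i - z) * (x i - w)) * (Matrix.vandermonde x).det := by
  simp only [Matrix.det_vandermonde, Fin.prod_univ_succ, Fin.prod_Ioi_zero, Fin.prod_Ioi_succ,
    Fin.cons_zero, Fin.cons_succ, Finset.prod_mul_distrib]
  ring

/-- The Jacobian density for one pair `a ± b i` of conjugate roots and real roots `x`. -/
def pairDensity {n : ℕ} (a b : ℝ) (x : Fin n → ℝ) : ℝ :=
  4 * b * (∏ i, ((x i - a) ^ 2 + b ^ 2)) * |(Matrix.vandermonde x).det|

lemma pairDensity_nonneg {n : ℕ} {a b : ℝ} (hb : 0 ≤ b) (x : Fin n → ℝ) :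
    0 ≤ pairDensity a b x := by
  have : 0 ≤ ∏ i, ((x i - a) ^ 2 + b ^ 2) := Finset.prod_nonneg fun i _ => by positivity
  unfold pairDensity
  positivity

lemma det_vandermonde_conj_pair {n : ℕ} (a b : ℝ) (x : Fin n → ℝ) :
    (Matrix.vandermonde (Fin.cons (a + b * Complex.I : ℂ) (Fin.cons (a - b * Complex.I : ℂ)
      fun i => (x i : ℂ)) : Fin (n + 2) → ℂ)).det =
      -2 * Complex.I * ((b * (∏ i, ((x i - a) ^ 2 + b ^ 2)) * (Matrix.vandermonde x).det : ℝ) : ℂ)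
    := by
  have h1 : ∀ i, ((x i : ℂ) - (a + b * Complex.I)) * ((x i : ℂ) - (a - b * Complex.I)) =
      (((x i - a) ^ 2 + b ^ 2 : ℝ) : ℂ) := fun i => by
    push_cast
    linear_combination -(b : ℂ) ^ 2 * Complex.I_sq
  have h2 : (Matrix.vandermonde fun i => (x i : ℂ)).det = ((Matrix.vandermonde x).det : ℝ) := by
    simp only [Matrix.det_vandermonde]
    push_cast
    rfl
  rw [det_vandermonde_cons_cons, h2]
  simp only [h1]
  push_cast
  ring

/-- The factor 2 is the Jacobian of `onePairMatrix`; together with |z - z̄| = 2b it accounts for the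
4b in `pairDensity`. -/
lemma norm_det_vandermonde_conj_pair {n : ℕ} (a : ℝ) {b : ℝ} (hb : 0 ≤ b) (x : Fin n → ℝ) :
    ‖(Matrix.vandermonde (Fin.cons (a + b * Complex.I : ℂ) (Fin.cons (a - b * Complex.I : ℂ)
      fun i => (x i : ℂ)) : Fin (n + 2) → ℂ)).det‖ * 2 = pairDensity a b x := by
  have : 0 ≤ ∏ i, ((x i - a) ^ 2 + b ^ 2) := Finset.prod_nonneg fun i _ => by positivity
  rw [det_vandermonde_conj_pair, norm_mul, Complex.norm_real, Real.norm_eq_abs, abs_mul, abs_mul,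
    abs_of_nonneg hb, abs_of_nonneg this, pairDensity]
  simp
  ring

/-- The monomial weights of the functional attached to a pair of conjugate roots. -/
def pairWeight (i j : ℕ) (p : ℝ × ℝ) : ℝ :=
  (2 * Complex.I * (p.1 + p.2 * Complex.I) ^ i * (p.1 - p.2 * Complex.I) ^ j).re

lemma continuous_pairWeight (i j : ℕ) : Continuous (pairWeight i j) := by
  unfold pairWeight
  fun_prop

lemma detCons_eq_sum_single {R : Type*} [CommRing R] {n : ℕ} (r : Fin (n + 1) → R)
    (A : Fin n → Fin (n + 1) → R) :
    detCons r A = ∑ a, r a * detCons (Pi.single a 1) A := by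
  rw [detCons_eq_sum]
  refine Finset.sum_congr rfl fun a _ => ?_
  rw [detCons_eq_sum, Finset.sum_eq_single a]
  · simp only [Pi.single_eq_same]
    ring
  · intro b _ hb
    simp [hb]
  · simp

lemma detCons_single_ofReal {n : ℕ} (i j : Fin (n + 2)) (x : Fin n → ℝ) :
    detCons (Pi.single i (1 : ℂ)) (Matrix.vecCons (Pi.single j 1)
      (powRows (n + 2) x · · |> Complex.ofReal)) =
    ((detCons (Pi.single i 1) (Matrix.vecCons (Pi.single j 1) (powRows (n + 2) x)) : ℝ) : ℂ) := by
  rw [detCons, detCons]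
  refine Eq.trans ?_ (Complex.ofRealHom.map_det _).symm
  congr 1
  ext k l
  refine Fin.cases ?_ (fun k => Fin.cases ?_ (fun k => ?_) k) k
  · simp [Pi.single_apply]
  · simp [Pi.single_apply]
  · simp

/-- Multilinearity in the two rows of z and z̄ separates the conjugate pair from the real roots,
although the density is not itself a product. -/
lemma pairDensity_eq_sum {n : ℕ} (a b : ℝ) (x : Fin n → ℝ) :
    pairDensity a b x = ∑ i : Fin (n + 2), ∑ j : Fin (n + 2), pairWeight i j (a, b) *
      (vandSgn x * detCons (Pi.single i 1)
        (Matrix.vecCons (Pi.single j 1) (powRows (n + 2) x))) := by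
  set z : ℂ := a + b * Complex.I
  set w : ℂ := a - b * Complex.I
  have h1 : Matrix.vandermonde (Fin.cons z (Fin.cons w fun i => (x i : ℂ)) : Fin (n + 2) → ℂ) =
      Matrix.of (Matrix.vecCons (fun k : Fin (n + 2) => z ^ (k : ℕ))
        (Matrix.vecCons (fun k : Fin (n + 2) => w ^ (k : ℕ))
        (powRows (n + 2) x · · |> Complex.ofReal))) := by
    ext k l
    rw [Matrix.vandermonde_apply]
    refine Fin.cases ?_ (fun k => Fin.cases ?_ (fun k => ?_) k) k
    · simp
    · simp
    · simp [powRows]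
  have h2 : (Matrix.vandermonde (Fin.cons z (Fin.cons w fun i => (x i : ℂ)) :
      Fin (n + 2) → ℂ)).det = ∑ i : Fin (n + 2), ∑ j : Fin (n + 2), z ^ (i : ℕ) * w ^ (j : ℕ) *
        ((detCons (Pi.single i 1)
          (Matrix.vecCons (Pi.single j 1) (powRows (n + 2) x)) : ℝ) : ℂ) := by
    rw [h1]
    change detCons _ _ = _
    rw [detCons_eq_sum_single]
    refine Finset.sum_congr rfl fun i _ => ?_
    rw [detCons_second_eq_sum, Finset.mul_sum]
    refine Finset.sum_congr rfl fun j _ => ?_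
    rw [detCons_single_ofReal]
    ring
  -- The determinant is -2i times a real number, so multiplication by 2i makes it real with
  -- coefficient 4; `vandSgn x` turns the remaining real Vandermonde determinant into its absolute
  -- value.
  have h3 : pairDensity a b x = vandSgn x * (2 * Complex.I * (Matrix.vandermonde
      (Fin.cons z (Fin.cons w fun i => (x i : ℂ)) : Fin (n + 2) → ℂ)).det).re := by
    rw [det_vandermonde_conj_pair]
    have : 2 * Complex.I * (-2 * Complex.I * ((b * (∏ i, ((x i - a) ^ 2 + b ^ 2)) *
        (Matrix.vandermonde x).det : ℝ) : ℂ)) = ((4 * (b * (∏ i, ((x i - a) ^ 2 + b ^ 2)) *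
        (Matrix.vandermonde x).det) : ℝ) : ℂ) := by
      push_cast
      linear_combination (-4 * (b * (∏ i, ((x i - a) ^ 2 + b ^ 2 : ℂ)) *
        ((Matrix.vandermonde x).det : ℂ))) * Complex.I_sq
    rw [this, Complex.ofReal_re, pairDensity, ← sgn_mul_self, vandSgn]
    ring
  rw [h3, h2]
  simp only [Finset.mul_sum, Complex.re_sum]
  refine Finset.sum_congr rfl fun i _ => Finset.sum_congr rfl fun j _ => ?_
  rw [pairWeight, ← mul_assoc, ← mul_assoc, Complex.re_mul_ofReal]
  ring

/-- The total mass of the density over the real roots. -/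
lemma integral_pairDensity {n : ℕ} (a b : ℝ) :
    ∫ x : Fin n → ℝ, pairDensity a b x ∂cubeMeasure n =
      ∑ i : Fin (n + 2), ∑ j : Fin (n + 2), pairWeight i j (a, b) * pairMoment n i j := by
  have hint : ∀ i j : Fin (n + 2), Integrable (fun x : Fin n → ℝ => vandSgn x *
      detCons (Pi.single i 1) (Matrix.vecCons (Pi.single j 1) (powRows (n + 2) x)))
      (cubeMeasure n) := fun i j =>
    integrable_cube (measurable_vandSgn _) abs_vandSgn_le (continuous_detCons_two _ _)
  simp only [pairDensity_eq_sum]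
  rw [integral_finsetSum _ fun i _ => integrable_finsetSum _ fun j _ => (hint i j).const_mul _]
  refine Finset.sum_congr rfl fun i _ => ?_
  rw [integral_finsetSum _ fun j _ => (hint i j).const_mul _]
  simp only [integral_const_mul, pairMoment]

/-- The open upper half of the unit disc. -/
def halfDisc : Set (ℝ × ℝ) := {p | p.1 ^ 2 + p.2 ^ 2 < 1 ∧ 0 < p.2}

lemma measurableSet_halfDisc : MeasurableSet halfDisc := by
  have h1 : IsOpen {p : ℝ × ℝ | p.1 ^ 2 + p.2 ^ 2 < 1} := isOpen_lt (by fun_prop) continuous_const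
  have h2 : IsOpen {p : ℝ × ℝ | 0 < p.2} := isOpen_lt continuous_const continuous_snd
  exact (h1.inter h2).measurableSet

lemma integrableOn_halfDisc {f : ℝ × ℝ → ℝ} (hf : Continuous f) : IntegrableOn f halfDisc := by
  refine (hf.continuousOn.integrableOn_compact
    (isCompact_Icc (a := ((-1, -1) : ℝ × ℝ)) (b := (1, 1)))).mono_set ?_
  rintro ⟨a, b⟩ ⟨h1, h2⟩
  simp only at h1 h2
  refine ⟨⟨?_, ?_⟩, ?_, ?_⟩ <;> simp only <;> nlinarith

lemma continuous_pairDensity (n : ℕ) :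
    Continuous fun v : Fin (n + 2) → ℝ => pairDensity (v 0) (v 1) (tail₂ v) := by
  have : Continuous fun v : Fin (n + 2) → ℝ => (tail₂ v : Fin n → ℝ) := by
    unfold tail₂; fun_prop
  have h2 := (continuous_det_vandermonde n).comp this
  unfold pairDensity
  have h3 : Continuous fun v : Fin (n + 2) → ℝ =>
      ∏ i : Fin n, ((tail₂ v i - v 0) ^ 2 + v 1 ^ 2) := by
    unfold tail₂; fun_prop
  exact ((continuous_const.mul (continuous_apply 1)).mul h3).mul h2.abs

lemma continuous_pairDensity_right {n : ℕ} (a b : ℝ) :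
    Continuous fun x : Fin n → ℝ => pairDensity a b x := by
  unfold pairDensity
  exact (Continuous.mul (by fun_prop) (continuous_det_vandermonde n).abs)

lemma pairDensity_comp {n : ℕ} (a b : ℝ) (σ : Equiv.Perm (Fin n)) (x : Fin n → ℝ) :
    pairDensity a b (x ∘ σ) = pairDensity a b x := by
  rw [pairDensity, abs_det_vandermonde_comp, pairDensity]
  congr 2
  exact Equiv.prod_comp σ fun i => (x i - a) ^ 2 + b ^ 2

lemma measurableSet_onePairParams (n : ℕ) : MeasurableSet (onePairParams n) := by
  have h1 : Measurable fun v : Fin (n + 2) → ℝ => (v 0, v 1) := by fun_prop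
  have h2 : Measurable fun v : Fin (n + 2) → ℝ => (tail₂ v : Fin n → ℝ) := by
    unfold tail₂; fun_prop
  exact (h1 measurableSet_halfDisc).inter (h2 (measurableSet_orderedRoots n))

lemma measurable_fin_cons {n : ℕ} (a : ℝ) :
    Measurable fun x : Fin n → ℝ => (Fin.cons a x : Fin (n + 1) → ℝ) := by
  refine measurable_pi_lambda _ fun i => ?_
  refine Fin.cases ?_ (fun i => ?_) i
  · exact measurable_const
  · exact measurable_pi_apply i

/-- The mass of the pair density, as a function of the complex root. -/
def pairMass (n : ℕ) (p : ℝ × ℝ) : ℝ := ∫ x : Fin n → ℝ, pairDensity p.1 p.2 x ∂cubeMeasure n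

lemma pairMass_eq_sum (n : ℕ) (p : ℝ × ℝ) : pairMass n p =
    ∑ i : Fin (n + 2), ∑ j : Fin (n + 2), pairWeight i j p * pairMoment n i j :=
  integral_pairDensity p.1 p.2

lemma continuous_pairMass (n : ℕ) : Continuous (pairMass n) := by
  have : pairMass n = fun p => ∑ i : Fin (n + 2), ∑ j : Fin (n + 2),
      pairWeight i j p * pairMoment n i j := funext (pairMass_eq_sum n)
  rw [this]
  exact continuous_finsetSum _ fun i _ => continuous_finsetSum _ fun j _ =>
    (continuous_pairWeight i j).mul continuous_const

/-- After the change of variables the coordinates a, b are peeled off by Tonelli. For fixed a, b the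
density is symmetric in the real roots, so n! ordered integrals fill the cube. -/
lemma volume_contractiveSetPairs_one (n : ℕ) :
    (n.factorial : ENNReal) * volume (contractiveSetPairs (n + 2) 1) =
      ENNReal.ofReal (∫ p in halfDisc, pairMass n p) := by
  have h := volume_image_coeff (onePairMatrix n)
    (fun v => coeffVec (n + 2) (onePairPoly v)) (fun v i => by
      have hpoly : (onePairPoly v).map (algebraMap ℝ ℂ) =
          ∏ j, (X - C ((onePairMatrix n).mulVec (fun k => (v k : ℂ)) j)) := by
        rw [onePairMatrix_mulVec, Fin.prod_univ_succ, Fin.prod_univ_succ, onePairPoly,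
          Polynomial.map_mul, map_quadPoly, map_rootPoly]
        simp only [Fin.cons_zero, Fin.cons_succ]
        rw [mul_assoc]
      rw [← hpoly, coeff_map]
      rfl) (measurableSet_onePairParams n) (injOn_coeffVec_onePairPoly n)
  have h1 : ∫⁻ v in onePairParams n, ENNReal.ofReal
      (‖(Matrix.vandermonde ((onePairMatrix n).mulVec fun k => (v k : ℂ))).det‖ *
        ‖(onePairMatrix n).det‖) =
      ∫⁻ v in onePairParams n, ENNReal.ofReal (pairDensity (v 0) (v 1) (tail₂ v)) := by
    refine setLIntegral_congr_fun (measurableSet_onePairParams n) fun v hv => ?_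
    rw [onePairMatrix_mulVec, norm_det_onePairMatrix, norm_det_vandermonde_conj_pair _ hv.1.2.le]
  set F : (Fin (n + 2) → ℝ) → ENNReal := (onePairParams n).indicator
    fun v => ENNReal.ofReal (pairDensity (v 0) (v 1) (tail₂ v)) with hF
  have hFm : Measurable F :=
    (continuous_pairDensity n).measurable.ennreal_ofReal.indicator (measurableSet_onePairParams n)
  have hFcons : ∀ a b (x : Fin n → ℝ), F (Fin.cons a (Fin.cons b x)) =
      halfDisc.indicator 1 (a, b) *
        (orderedRoots n).indicator (fun x => ENNReal.ofReal (pairDensity a b x)) x := by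
    intro a b x
    have hiff : (Fin.cons a (Fin.cons b x) : Fin (n + 2) → ℝ) ∈ onePairParams n ↔
        (a, b) ∈ halfDisc ∧ x ∈ orderedRoots n := Iff.rfl
    by_cases hD : (a, b) ∈ halfDisc
    · by_cases hx : x ∈ orderedRoots n
      · rw [hF, Set.indicator_of_mem (hiff.2 ⟨hD, hx⟩), Set.indicator_of_mem hD,
          Set.indicator_of_mem hx, Pi.one_apply, one_mul]
        rfl
      · rw [hF, Set.indicator_of_notMem fun hh => hx (hiff.1 hh).2,
          Set.indicator_of_notMem hx, mul_zero]
    · rw [hF, Set.indicator_of_notMem fun hh => hD (hiff.1 hh).1,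
        Set.indicator_of_notMem hD, zero_mul]
  have hdm : ∀ a b : ℝ, Measurable fun x : Fin n → ℝ => ENNReal.ofReal (pairDensity a b x) :=
    fun a b => (continuous_pairDensity_right a b).measurable.ennreal_ofReal
  have hinner : ∀ a b : ℝ, (n.factorial : ENNReal) *
      ∫⁻ x : Fin n → ℝ, F (Fin.cons a (Fin.cons b x)) =
      halfDisc.indicator (fun p => ENNReal.ofReal (pairMass n p)) (a, b) := by
    intro a b
    simp only [hFcons]
    rw [lintegral_const_mul _ ((hdm a b).indicator (measurableSet_orderedRoots n)),
      lintegral_indicator (measurableSet_orderedRoots n), mul_left_comm,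
      factorial_mul_lintegral_orderedRoots _ (hdm a b) fun σ x => by rw [pairDensity_comp]]
    by_cases hD : (a, b) ∈ halfDisc
    · rw [Set.indicator_of_mem hD, Set.indicator_of_mem hD, Pi.one_apply, one_mul, pairMass,
        ofReal_integral_eq_lintegral_ofReal]
      · have := integrable_cube (n := n) (s := fun _ => 1) measurable_const (by simp)
          (continuous_pairDensity_right a b)
        simpa using this
      · exact Filter.Eventually.of_forall fun x => pairDensity_nonneg hD.2.le x
    · rw [Set.indicator_of_notMem hD, Set.indicator_of_notMem hD, zero_mul]
  have hfac : (n.factorial : ENNReal) ≠ ⊤ := ENNReal.natCast_ne_top _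
  rw [contractiveSetPairs_one_eq_image, h, h1,
    ← lintegral_indicator (measurableSet_onePairParams n), ← hF, lintegral_fin_succ F hFm,
    ← lintegral_const_mul' _ _ hfac,
    ofReal_integral_eq_lintegral_ofReal (integrableOn_halfDisc (continuous_pairMass n)),
    ← lintegral_indicator measurableSet_halfDisc, Measure.volume_eq_prod, lintegral_prod]
  · refine lintegral_congr fun a => ?_
    rw [lintegral_fin_succ (fun x => F (Fin.cons a x)) (hFm.comp (measurable_fin_cons a)),
      ← lintegral_const_mul' _ _ hfac]
    exact lintegral_congr fun b => hinner a b
  · exact ((continuous_pairMass n).measurable.ennreal_ofReal.indicator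
      measurableSet_halfDisc).aemeasurable
  · refine (ae_restrict_iff' measurableSet_halfDisc).2 (Filter.Eventually.of_forall fun p hp => ?_)
    exact integral_nonneg fun x => pairDensity_nonneg hp.2.le x

/-- The volume of the contractive polynomials with one pair of conjugate roots. -/
theorem contractiveVol_one (n : ℕ) : volume (contractiveSetPairs (n + 2) 1) ≠ ⊤ ∧
    n.factorial * contractiveVol (n + 2) 1 = ∑ i : Fin (n + 2), ∑ j : Fin (n + 2),
      (∫ p in halfDisc, pairWeight i j p) * pairMoment n i j := by
  have h := volume_contractiveSetPairs_one n
  have hd : (n.factorial : ENNReal) ≠ 0 := by exact_mod_cast n.factorial_ne_zero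
  constructor
  · intro htop
    rw [htop, ENNReal.mul_top hd] at h
    exact ENNReal.ofReal_ne_top h.symm
  · have h0 : 0 ≤ ∫ p in halfDisc, pairMass n p :=
      setIntegral_nonneg measurableSet_halfDisc fun p hp =>
        integral_nonneg fun x => pairDensity_nonneg hp.2.le x
    have h1 := congrArg ENNReal.toReal h
    rw [ENNReal.toReal_mul, ENNReal.toReal_natCast, ENNReal.toReal_ofReal h0] at h1
    rw [contractiveVol, h1]
    simp only [pairMass_eq_sum]
    have hint : ∀ i j : Fin (n + 2), IntegrableOn (fun p => pairWeight i j p * pairMoment n i j)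
        halfDisc := fun i j =>
      integrableOn_halfDisc ((continuous_pairWeight i j).mul continuous_const)
    rw [integral_finsetSum _ fun i _ => integrable_finsetSum _ fun j _ => hint i j]
    refine Finset.sum_congr rfl fun i _ => ?_
    rw [integral_finsetSum _ fun j _ => hint i j]
    simp only [integral_mul_const]

/-! ### Half-disc integrals of the weights -/

lemma pairWeight_polar (i j : ℕ) (r θ : ℝ) :
    pairWeight i j (r * Real.cos θ, r * Real.sin θ) =
      r ^ (i + j) * (-2 * Real.sin (((i : ℝ) - j) * θ)) := by
  have h1 : ((r * Real.cos θ : ℝ) : ℂ) + ((r * Real.sin θ : ℝ) : ℂ) * Complex.I =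
      r * Complex.exp (θ * Complex.I) := by
    rw [Complex.exp_mul_I]; push_cast; ring
  have h2 : ((r * Real.cos θ : ℝ) : ℂ) - ((r * Real.sin θ : ℝ) : ℂ) * Complex.I =
      r * Complex.exp (-θ * Complex.I) := by
    rw [Complex.exp_mul_I, Complex.cos_neg, Complex.sin_neg]; push_cast; ring
  have h3 : 2 * Complex.I * (r * Complex.exp (θ * Complex.I)) ^ i *
      (r * Complex.exp (-θ * Complex.I)) ^ j = ((r ^ (i + j) : ℝ) : ℂ) *
      (2 * Complex.I * Complex.exp (((((i : ℝ) - j) * θ : ℝ) : ℂ) * Complex.I)) := by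
    rw [mul_pow, mul_pow, ← Complex.exp_nat_mul, ← Complex.exp_nat_mul]
    have : Complex.exp (((((i : ℝ) - j) * θ : ℝ) : ℂ) * Complex.I) =
        Complex.exp (i * (θ * Complex.I)) * Complex.exp (j * (-θ * Complex.I)) := by
      rw [← Complex.exp_add]
      congr 1
      push_cast
      ring
    rw [this]
    push_cast
    ring
  rw [pairWeight]
  simp only
  rw [h1, h2, h3, Complex.re_ofReal_mul]
  congr 1
  generalize ((i : ℝ) - j) * θ = c
  rw [Complex.exp_mul_I, ← Complex.ofReal_cos, ← Complex.ofReal_sin]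
  generalize Real.cos c = u
  generalize Real.sin c = v
  simp [Complex.mul_re, Complex.mul_im]

lemma integral_sin_const_mul (c : ℝ) (hc : c ≠ 0) :
    ∫ θ in (0 : ℝ)..Real.pi, -2 * Real.sin (c * θ) = -2 * ((1 - Real.cos (c * Real.pi)) / c) := by
  rw [intervalIntegral.integral_const_mul, intervalIntegral.integral_comp_mul_left _ hc,
    integral_sin]
  simp
  ring

/-- Polar coordinates in the half disc. -/
lemma integral_halfDisc_pairWeight (i j : ℕ) :
    ∫ p in halfDisc, pairWeight i j p = 1 / ((i : ℝ) + j + 2) *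
      ∫ θ in (0 : ℝ)..Real.pi, -2 * Real.sin (((i : ℝ) - j) * θ) := by
  rw [← integral_indicator measurableSet_halfDisc, ← integral_comp_polarCoord_symm]
  have hset : ∀ p ∈ polarCoord.target, p.1 • halfDisc.indicator (pairWeight i j)
      (polarCoord.symm p) = (Set.Ioo (0 : ℝ) 1 ×ˢ Set.Ioo 0 Real.pi).indicator
      (fun p => p.1 ^ (i + j + 1) * (-2 * Real.sin (((i : ℝ) - j) * p.2))) p := by
    rintro ⟨r, θ⟩ ⟨hr, hθ⟩
    simp only [Set.mem_Ioi, Set.mem_Ioo] at hr hθ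
    have hiff : (r * Real.cos θ, r * Real.sin θ) ∈ halfDisc ↔
        (r, θ) ∈ Set.Ioo (0 : ℝ) 1 ×ˢ Set.Ioo 0 Real.pi := by
      have h1 : (r * Real.cos θ) ^ 2 + (r * Real.sin θ) ^ 2 = r ^ 2 := by
        linear_combination r ^ 2 * Real.sin_sq_add_cos_sq θ
      have h2 : r ^ 2 < 1 ↔ r < 1 := by
        rw [sq_lt_one_iff₀ hr.le]
      have h3 : 0 < r * Real.sin θ ↔ 0 < θ := by
        rw [mul_pos_iff_of_pos_left hr]
        constructor
        · intro h
          by_contra hle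
          exact absurd h (not_lt.2 (Real.sin_nonpos_of_nonpos_of_neg_pi_le (not_lt.1 hle) hθ.1.le))
        · exact fun h => Real.sin_pos_of_pos_of_lt_pi h hθ.2
      change (_ < _ ∧ _ < _) ↔ _
      simp only [h1, h2, h3, Set.mem_prod, Set.mem_Ioo, hr, hθ.2, true_and, and_true]
    rw [polarCoord_symm_apply]
    simp only
    by_cases h : (r, θ) ∈ Set.Ioo (0 : ℝ) 1 ×ˢ Set.Ioo 0 Real.pi
    · rw [Set.indicator_of_mem h, Set.indicator_of_mem (hiff.2 h), pairWeight_polar, smul_eq_mul]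
      ring
    · rw [Set.indicator_of_notMem h, Set.indicator_of_notMem fun hh => h (hiff.1 hh), smul_zero]
  rw [setIntegral_congr_fun polarCoord.open_target.measurableSet hset,
    setIntegral_indicator (measurableSet_Ioo.prod measurableSet_Ioo),
    Set.inter_eq_right.2, Measure.volume_eq_prod,
    setIntegral_prod_mul (fun r : ℝ => r ^ (i + j + 1))
      (fun θ : ℝ => -2 * Real.sin (((i : ℝ) - j) * θ)), ← integral_Ioc_eq_integral_Ioo,
    ← integral_Ioc_eq_integral_Ioo, ← intervalIntegral.integral_of_le zero_le_one,
    ← intervalIntegral.integral_of_le Real.pi_pos.le, integral_pow]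
  · congr 1
    push_cast
    rw [one_pow, zero_pow (by omega)]
    ring
  · rintro ⟨r, θ⟩ ⟨hr, hθ⟩
    exact ⟨hr.1, by have := Real.pi_pos; linarith [hθ.1], hθ.2⟩

/-- The angle covers only a half turn, so sin((i-j)θ) integrates to (1 - cos((i-j)π))/(i-j), and the
parity of i - j decides. -/
lemma integral_halfDisc_pairWeight_of_even {i j : ℕ} (h : Even (i + j)) :
    ∫ p in halfDisc, pairWeight i j p = 0 := by
  rw [integral_halfDisc_pairWeight]
  by_cases hij : (i : ℝ) - j = 0
  · simp [hij]
  · have hcos : Real.cos (((i : ℝ) - j) * Real.pi) = 1 := by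
      rw [Real.cos_eq_one_iff]
      obtain ⟨k, hk⟩ := h
      refine ⟨k - j, ?_⟩
      have : (i : ℝ) + j = k + k := by exact_mod_cast hk
      push_cast
      linear_combination (-Real.pi) * this
    rw [integral_sin_const_mul _ hij, hcos]
    simp

lemma integral_halfDisc_pairWeight_of_odd {i j : ℕ} (h : Odd (i + j)) :
    ∫ p in halfDisc, pairWeight i j p = -4 / (((i : ℝ) + j + 2) * ((i : ℝ) - j)) := by
  have hij : (i : ℝ) - j ≠ 0 := by
    intro h0
    have : i = j := by exact_mod_cast sub_eq_zero.1 h0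
    subst this
    exact (Nat.not_odd_iff_even.2 ⟨i, rfl⟩) h
  have hcos : Real.cos (((i : ℝ) - j) * Real.pi) = -1 := by
    rw [Real.cos_eq_neg_one_iff]
    obtain ⟨k, hk⟩ := h
    refine ⟨k - j, ?_⟩
    have : (i : ℝ) + j = 2 * k + 1 := by exact_mod_cast hk
    push_cast
    linear_combination (-Real.pi) * this
  rw [integral_halfDisc_pairWeight, integral_sin_const_mul _ hij, hcos]
  have : (i : ℝ) + j + 2 ≠ 0 := by positivity
  field_simp
  ring

/-! ### Cauchy systems -/

/-- Clearing denominators turns a sum of simple fractions into a polynomial in s, to which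
interpolation applies. -/
lemma sum_div_add_eq {ι : Type*} [DecidableEq ι] (O : Finset ι) (ξ h : ι → ℝ) (s : ℝ)
    (hs : ∀ i ∈ O, ξ i + s ≠ 0) :
    (∑ i ∈ O, C (h i) * ∏ k ∈ O.erase i, (X + C (ξ k))).eval s =
      (∏ i ∈ O, (ξ i + s)) * ∑ i ∈ O, h i / (ξ i + s) := by
  rw [eval_finsetSum, Finset.mul_sum]
  refine Finset.sum_congr rfl fun i hi => ?_
  rw [← Finset.mul_prod_erase O _ hi, eval_mul, eval_C, eval_prod]
  simp only [eval_add, eval_X, eval_C]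
  have := hs i hi
  rw [Finset.prod_congr rfl fun k _ => add_comm s (ξ k)]
  field_simp

/-- Solution of a Cauchy system: a combination of the functions `1 / (ξ i + s)` vanishing at all
nodes `η e` but one is determined at the negative of that node. -/
lemma cauchy_system {ι κ : Type*} [DecidableEq ι] [DecidableEq κ] (O : Finset ι) (E : Finset κ)
    (ξ h : ι → ℝ) (η : κ → ℝ) (hη : Set.InjOn η E) {y : κ} (hy : y ∈ E) (V : ℝ)
    (hpos : ∀ i ∈ O, ∀ e ∈ E, ξ i + η e ≠ 0) (hne : ∀ i ∈ O, ξ i - η y ≠ 0)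
    (heq : ∀ e ∈ E, ∑ i ∈ O, h i / (ξ i + η e) = if e = y then V else 0)
    (hcard : O.card ≤ E.card ∨ (O.card = E.card + 1 ∧ ∑ i ∈ O, h i = 0)) :
    ∑ i ∈ O, h i / (η y - ξ i) =
      -(V * (∏ e ∈ E.erase y, (η y + η e) / (η e - η y)) *
        ∏ i ∈ O, (η y + ξ i) / (ξ i - η y)) := by
  set P : ℝ[X] := ∑ i ∈ O, C (h i) * ∏ k ∈ O.erase i, (X + C (ξ k)) with hP
  set T : ℝ[X] := ∏ e ∈ E.erase y, (X - C (η e)) with hT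
  have hmonic : ∀ i, (∏ k ∈ O.erase i, (X + C (ξ k))).Monic := fun i =>
    monic_prod_of_monic _ _ fun _ _ => monic_X_add_C _
  have hnat : ∀ i ∈ O, (∏ k ∈ O.erase i, (X + C (ξ k))).natDegree = O.card - 1 := fun i hi => by
    rw [natDegree_prod_of_monic _ _ fun _ _ => monic_X_add_C _]
    simp [Finset.card_erase_of_mem hi]
  -- Each summand has degree |O| - 1. If |O| = |E| + 1 this is one too large, and the hypothesis ∑ h
  -- = 0 kills the leading coefficient.
  have hPdeg : P.degree < E.card := by
    rw [degree_lt_iff_coeff_zero]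
    intro m hm
    rw [hP, finsetSum_coeff]
    simp only [coeff_C_mul]
    by_cases hlt : O.card - 1 < m
    · exact Finset.sum_eq_zero fun i hi => by
        rw [coeff_eq_zero_of_natDegree_lt (by rw [hnat i hi]; exact hlt), mul_zero]
    · rcases O.eq_empty_or_nonempty with hO | hO
      · simp [hO]
      · have h1 := hO.card_pos
        have hEpos : 0 < E.card := Finset.card_pos.2 ⟨y, hy⟩
        rcases hcard with hc | ⟨hc, hsum⟩
        · omega
        · have hmeq : m = O.card - 1 := by omega
          rw [← hsum]
          refine Finset.sum_congr rfl fun i hi => ?_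
          have := (hmonic i).coeff_natDegree
          rw [hnat i hi, ← hmeq] at this
          rw [this, mul_one]
  have hTdeg : T.degree < E.card := by
    have hTm : T.Monic := monic_prod_of_monic _ _ fun _ _ => monic_X_sub_C _
    rw [degree_eq_natDegree hTm.ne_zero, hT,
      natDegree_prod_of_monic _ _ fun _ _ => monic_X_sub_C _]
    have := Finset.card_pos.2 ⟨y, hy⟩
    simp only [natDegree_X_sub_C, Finset.sum_const, smul_eq_mul, mul_one,
      Finset.card_erase_of_mem hy]
    exact_mod_cast (by omega : E.card - 1 < E.card)
  have hPe : ∀ e ∈ E, P.eval (η e) = (∏ i ∈ O, (ξ i + η e)) * if e = y then V else 0 :=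
    fun e he => by rw [hP, sum_div_add_eq O ξ h _ fun i hi => hpos i hi e he, heq e he]
  have hTe : ∀ e ∈ E, e ≠ y → T.eval (η e) = 0 := fun e he hey => by
    rw [hT, eval_prod, Finset.prod_eq_zero (i := e) (by simp [he, hey]) (by simp)]
  -- P and T both vanish at every node except η y and have degree below the number of nodes, so they
  -- are proportional.
  have hzero : P * C (T.eval (η y)) - C (P.eval (η y)) * T = 0 := by
    refine eq_zero_of_degree_lt_of_eval_index_eq_zero E hη ?_ fun e he => ?_
    · refine lt_of_le_of_lt (degree_sub_le _ _) (max_lt ?_ ?_)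
      · rw [mul_comm, ← smul_eq_C_mul]
        exact lt_of_le_of_lt (degree_smul_le _ _) hPdeg
      · rw [← smul_eq_C_mul]
        exact lt_of_le_of_lt (degree_smul_le _ _) hTdeg
    · rw [eval_sub, eval_mul, eval_mul, eval_C, eval_C]
      by_cases hey : e = y
      · subst hey; ring
      · rw [hTe e he hey, hPe e he, if_neg hey]; ring
  -- At s = -η y the denominators ξ i + s become ξ i - η y, those of the desired sum up to sign.
  have hev := congrArg (eval (-η y)) hzero
  rw [eval_sub, eval_mul, eval_mul, eval_C, eval_C, eval_zero, hPe y hy, if_pos rfl, hP,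
    sum_div_add_eq O ξ h _ fun i hi => by rw [← sub_eq_add_neg]; exact hne i hi, hT, eval_prod,
    eval_prod] at hev
  simp only [eval_sub, eval_X, eval_C, ← sub_eq_add_neg] at hev
  have e1 : ∏ e ∈ E.erase y, (-η y - η e) =
      (∏ e ∈ E.erase y, (-1 : ℝ)) * ∏ e ∈ E.erase y, (η y + η e) := by
    rw [← Finset.prod_mul_distrib]
    exact Finset.prod_congr rfl fun e _ => by ring
  have e2 : ∏ e ∈ E.erase y, (η y - η e) =
      (∏ e ∈ E.erase y, (-1 : ℝ)) * ∏ e ∈ E.erase y, (η e - η y) := by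
    rw [← Finset.prod_mul_distrib]
    exact Finset.prod_congr rfl fun e _ => by ring
  have e3 : ∏ i ∈ O, (ξ i + η y) = ∏ i ∈ O, (η y + ξ i) :=
    Finset.prod_congr rfl fun i _ => add_comm _ _
  have n1 : ∏ e ∈ E.erase y, (-1 : ℝ) ≠ 0 := Finset.prod_ne_zero_iff.2 fun _ _ => by norm_num
  have n2 : ∏ e ∈ E.erase y, (η e - η y) ≠ 0 := Finset.prod_ne_zero_iff.2 fun e he =>
    sub_ne_zero.2 fun h' => (Finset.mem_erase.1 he).1 (hη (Finset.mem_erase.1 he).2 hy h')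
  have n3 : ∏ i ∈ O, (ξ i - η y) ≠ 0 := Finset.prod_ne_zero_iff.2 hne
  have e4 : ∑ i ∈ O, h i / (η y - ξ i) = -∑ i ∈ O, h i / (ξ i - η y) := by
    rw [← Finset.sum_neg_distrib]
    exact Finset.sum_congr rfl fun i _ => by rw [← neg_sub (ξ i), div_neg]
  rw [e1, e2, e3] at hev
  rw [e4, neg_inj, Finset.prod_div_distrib, Finset.prod_div_distrib]
  have hev' : (∏ i ∈ O, (ξ i - η y)) * (∑ i ∈ O, h i / (ξ i - η y)) *
      (∏ e ∈ E.erase y, (η e - η y)) =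
      (∏ i ∈ O, (η y + ξ i)) * V * ∏ e ∈ E.erase y, (η y + η e) := by
    refine mul_left_cancel₀ n1 ?_
    linear_combination hev
  field_simp
  linear_combination hev'

/-! ### Factorial products and Legendre polynomials -/

lemma prod_range_erase_sub (d b : ℕ) (hb : b < d) :
    ∏ k ∈ (Finset.range d).erase b, ((k : ℝ) - b) =
      (-1) ^ b * b.factorial * (d - 1 - b).factorial := by
  induction d, hb using Nat.le_induction with
  | base =>
    have h : (Finset.range (b + 1)).erase b = Finset.range b := by
      rw [Finset.range_add_one, Finset.erase_insert Finset.notMem_range_self]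
    have h2 : b + 1 - 1 - b = 0 := by omega
    rw [Nat.succ_eq_add_one, h, h2, ← Finset.prod_range_reflect,
      ← Finset.prod_range_add_one_eq_factorial]
    push_cast
    have h3 : ((-1 : ℝ)) ^ b = ∏ _k ∈ Finset.range b, (-1 : ℝ) := by simp
    rw [h3, ← Finset.prod_mul_distrib, Nat.factorial_zero, Nat.cast_one, mul_one]
    refine Finset.prod_congr rfl fun k hk => ?_
    have hk := Finset.mem_range.1 hk
    have : ((b - 1 - k : ℕ) : ℝ) + (k + 1) = b := by
      exact_mod_cast (by omega : b - 1 - k + (k + 1) = b)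
    linear_combination this
  | succ d hd ih =>
    have h : (Finset.range (d + 1)).erase b = insert d ((Finset.range d).erase b) := by
      rw [Finset.range_add_one, Finset.erase_insert_of_ne (by omega)]
    have h2 : d + 1 - 1 - b = (d - 1 - b) + 1 := by omega
    rw [h, Finset.prod_insert (by simp), ih, h2, Nat.factorial_succ]
    have : ((d - 1 - b : ℕ) : ℝ) + 1 = d - b := by
      rw [eq_sub_iff_add_eq]
      exact_mod_cast (by omega : d - 1 - b + 1 + b = d)
    push_cast
    rw [this]
    ring

lemma factorial_mul_prod_range (d y : ℕ) :
    (y.factorial : ℝ) * ∏ k ∈ Finset.range d, ((y : ℝ) + (k + 1)) = (y + d).factorial := by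
  induction d with
  | zero => simp
  | succ d ih =>
    rw [Finset.prod_range_succ, ← mul_assoc, ih, ← add_assoc y d 1, Nat.factorial_succ]
    push_cast
    ring

/-- The coefficients of the shifted Legendre polynomial, up to sign. -/
def legendreCoeff (d k : ℕ) : ℕ := (d + k).choose (2 * k) * (2 * k).choose k

lemma legendreCoeff_mul_factorial {d k : ℕ} (h : k ≤ d) :
    (legendreCoeff d k : ℝ) * (k.factorial * k.factorial * (d - k).factorial) =
      (d + k).factorial := by
  have h1 := Nat.choose_mul_factorial_mul_factorial (n := d + k) (k := 2 * k) (by omega)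
  have h2 := Nat.choose_mul_factorial_mul_factorial (n := 2 * k) (k := k) (by omega)
  rw [show d + k - 2 * k = d - k by omega] at h1
  rw [show 2 * k - k = k by omega] at h2
  rw [← h1, ← h2, legendreCoeff]
  push_cast
  ring

/-- With k = b + 1, the numerators are (d+k)!/k! without the factor 2k, and the denominators are
(-1)^b b! (d-k)!. The quotient is thus ∓(d+k)!/(2 k! k! (d-k)!), negative since b is odd. -/
lemma prod_range_erase_div {d b : ℕ} (hb : b < d) (hodd : Odd b) :
    ∏ k ∈ (Finset.range d).erase b, (((b : ℝ) + 1 + (k + 1)) / ((k + 1) - (b + 1))) =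
      -(legendreCoeff d (b + 1) / 2) := by
  have h1 := prod_range_erase_sub d b hb
  have h2 := factorial_mul_prod_range d (b + 1)
  rw [← Finset.mul_prod_erase _ _ (Finset.mem_range.2 hb)] at h2
  push_cast at h2
  have h3 := legendreCoeff_mul_factorial (d := d) (k := b + 1) hb
  rw [hodd.neg_one_pow] at h1
  rw [Finset.prod_div_distrib]
  have h4 : ∏ k ∈ (Finset.range d).erase b, ((k : ℝ) + 1 - (b + 1)) =
      ∏ k ∈ (Finset.range d).erase b, ((k : ℝ) - b) := Finset.prod_congr rfl fun k _ => by ring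
  have h5 : d - 1 - b = d - (b + 1) := by omega
  rw [h4, h1, h5]
  rw [add_comm d (b + 1), ← h2, Nat.factorial_succ] at h3
  have p1 : (b.factorial : ℝ) ≠ 0 := by exact_mod_cast b.factorial_ne_zero
  have p2 : ((d - (b + 1)).factorial : ℝ) ≠ 0 := by exact_mod_cast Nat.factorial_ne_zero _
  have p3 : (b : ℝ) + 1 ≠ 0 := by positivity
  rw [div_eq_iff (by simp [p1, p2])]
  push_cast at h3
  refine mul_left_cancel₀ (mul_ne_zero (mul_ne_zero p3 p1) (mul_ne_zero two_ne_zero p3)) ?_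
  linear_combination -h3

/-- Rodrigues' formula expanded about 1: X² - 1 = (X - 1)((X - 1) + 2), and differentiating d times
lowers (X - 1)^(d+k) to (X - 1)^k. -/
lemma eval_iterate_derivative_shifted (d : ℕ) (x : ℝ) :
    (derivative^[d] ((X ^ 2 - 1 : ℝ[X]) ^ d)).eval x =
      2 ^ d * d.factorial * ∑ k ∈ Finset.range (d + 1),
        (legendreCoeff d k : ℝ) * ((x - 1) / 2) ^ k := by
  have h1 : (X ^ 2 - 1 : ℝ[X]) ^ d = ∑ k ∈ Finset.range (d + 1),
      C ((2 : ℝ) ^ (d - k) * d.choose k) * (X - C 1) ^ (d + k) := by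
    have : (X ^ 2 - 1 : ℝ[X]) = (X - C 1) * ((X - C 1) + C 2) := by
      rw [show (2 : ℝ) = 1 + 1 by norm_num, C_add, C_1]
      ring
    rw [this, mul_pow, add_pow, Finset.mul_sum]
    refine Finset.sum_congr rfl fun k _ => ?_
    rw [C_mul, C_pow, pow_add, ← C_eq_natCast]
    ring
  rw [h1, iterate_derivative_sum, eval_finsetSum, Finset.mul_sum]
  refine Finset.sum_congr rfl fun k hk => ?_
  have hk : k ≤ d := Nat.lt_succ_iff.1 (Finset.mem_range.1 hk)
  rw [iterate_derivative_C_mul, iterate_derivative_X_sub_pow, eval_mul, eval_C, eval_smul,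
    eval_pow, eval_sub, eval_X, eval_C, Nat.add_sub_cancel_left, nsmul_eq_mul,
    Nat.descFactorial_eq_factorial_mul_choose]
  have h2 : legendreCoeff d k = d.choose k * (d + k).choose d := by
    rw [legendreCoeff, Nat.choose_mul (by omega), mul_comm, show d + k - k = d by omega,
      show 2 * k - k = k by omega, Nat.choose_symm_add]
  have h3 : (2 : ℝ) ^ d = 2 ^ (d - k) * 2 ^ k := by rw [← pow_add, Nat.sub_add_cancel hk]
  rw [h2, h3, div_pow]
  push_cast
  field_simp

/-- The same derivative expanded about 0; terms with 2k > d are killed. Comparing both expansions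
gives the two forms of the Legendre polynomial. -/
lemma eval_iterate_derivative_legendre (d : ℕ) (x : ℝ) :
    (derivative^[d] ((X ^ 2 - 1 : ℝ[X]) ^ d)).eval x = 2 ^ d * d.factorial * legendreP d x := by
  have h1 : (X ^ 2 - 1 : ℝ[X]) ^ d = ∑ k ∈ Finset.range (d + 1),
      C ((-1 : ℝ) ^ k * d.choose k) * X ^ (2 * d - 2 * k) := by
    rw [sub_eq_neg_add, add_pow]
    refine Finset.sum_congr rfl fun k _ => ?_
    rw [C_mul, C_pow, C_neg, C_1, ← C_eq_natCast, ← pow_mul, Nat.mul_sub]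
    ring
  have hsub : Finset.range (d / 2 + 1) ⊆ Finset.range (d + 1) := by
    intro k
    simp only [Finset.mem_range]
    omega
  rw [h1, iterate_derivative_sum, eval_finsetSum, legendreP, mul_assoc, mul_left_comm,
    mul_inv_cancel_left₀ (by positivity), Finset.mul_sum, ← Finset.sum_subset hsub]
  · refine Finset.sum_congr rfl fun k hk => ?_
    have hk : 2 * k ≤ d := by have := Finset.mem_range.1 hk; omega
    rw [iterate_derivative_C_mul, iterate_derivative_X_pow_eq_natCast_mul, eval_mul, eval_C,
      eval_mul, eval_natCast, eval_pow, eval_X, Nat.descFactorial_eq_factorial_mul_choose]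
    have h2 : (2 * d - 2 * k).choose d * d.choose k =
        (2 * d - 2 * k).choose (d - k) * (d - k).choose k := by
      rw [← Nat.choose_symm (by omega : k ≤ d), Nat.choose_mul (by omega),
        show 2 * d - 2 * k - (d - k) = d - k by omega, show d - (d - k) = k by omega]
    have h3 : ((2 * d - 2 * k).choose d : ℝ) * d.choose k =
        (2 * d - 2 * k).choose (d - k) * (d - k).choose k := by exact_mod_cast h2
    rw [show 2 * d - 2 * k - d = d - 2 * k by omega]
    push_cast
    linear_combination (-1 : ℝ) ^ k * d.factorial * x ^ (d - 2 * k) * h3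
  · intro k hk hk'
    have h2 : 2 * d - 2 * k < d := by
      have := Finset.mem_range.1 hk
      have := mt Finset.mem_range.2 hk'
      omega
    rw [iterate_derivative_C_mul, iterate_derivative_X_pow_eq_natCast_mul,
      Nat.descFactorial_of_lt h2]
    simp

/-- The two expressions for the Legendre polynomial agree. -/
theorem legendreP_eq_sum (d : ℕ) (x : ℝ) : legendreP d x =
    ∑ k ∈ Finset.range (d + 1), (legendreCoeff d k : ℝ) * ((x - 1) / 2) ^ k := by
  have h := (eval_iterate_derivative_legendre d x).symm.trans (eval_iterate_derivative_shifted d x)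
  exact mul_left_cancel₀ (by positivity) h

lemma legendreCoeff_zero (d : ℕ) : legendreCoeff d 0 = 1 := by simp [legendreCoeff]

lemma legendreP_one (d : ℕ) : legendreP d 1 = 1 := by
  rw [legendreP_eq_sum, Finset.sum_range_succ']
  simp [legendreCoeff_zero]

lemma legendreP_neg (d : ℕ) (x : ℝ) : legendreP d (-x) = (-1) ^ d * legendreP d x := by
  rw [legendreP, legendreP, mul_left_comm ((-1 : ℝ) ^ d), Finset.mul_sum _ _ ((-1 : ℝ) ^ d)]
  congr 1
  refine Finset.sum_congr rfl fun k hk => ?_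
  have hk : 2 * k ≤ d := by have := Finset.mem_range.1 hk; omega
  have h : (-1 : ℝ) ^ d = (-1) ^ (d - 2 * k) := by
    conv_lhs => rw [← Nat.sub_add_cancel hk, pow_add, pow_mul]
    simp
  rw [neg_pow, h]
  ring

lemma sum_one_sub_neg_one_pow (m : ℕ) :
    ∑ j ∈ Finset.range m, (1 - (-1 : ℝ) ^ j) = m - (1 - (-1) ^ m) / 2 := by
  induction m with
  | zero => simp
  | succ m ih =>
    rw [Finset.sum_range_succ, ih, pow_succ]
    push_cast
    ring

/-- At x = 3 and x = -1 the quantity (x-1)/2 is 1 and -1, so averaging P_d(3) and P_d(-1) = (-1)^d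
selects the coefficients of even index. The index 0 is absent from the sum, and the subtracted ones
number ⌊d/2⌋. -/
lemma sum_range_ite_odd_legendreCoeff (d : ℕ) :
    ∑ j ∈ Finset.range d, (if Odd j then (legendreCoeff d (j + 1) : ℝ) / 2 - 1 else 0) =
      (legendreP d 3 - 2 * (d : ℝ) - 1) / 4 := by
  have h3 : legendreP d 3 = (∑ j ∈ Finset.range d, (legendreCoeff d (j + 1) : ℝ)) + 1 := by
    rw [legendreP_eq_sum, Finset.sum_range_succ']
    norm_num [legendreCoeff_zero]
  have h1 : (-1 : ℝ) ^ d =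
      (∑ j ∈ Finset.range d, (legendreCoeff d (j + 1) : ℝ) * (-1) ^ (j + 1)) + 1 := by
    have := legendreP_neg d 1
    rw [legendreP_one, mul_one, legendreP_eq_sum, Finset.sum_range_succ'] at this
    rw [← this]
    norm_num [legendreCoeff_zero]
  have h2 := sum_one_sub_neg_one_pow d
  have h4 : ∀ j : ℕ, (if Odd j then (legendreCoeff d (j + 1) : ℝ) / 2 - 1 else 0) =
      ((legendreCoeff d (j + 1) : ℝ) + legendreCoeff d (j + 1) * (-1) ^ (j + 1) -
        2 * (1 - (-1) ^ j)) / 4 := by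
    intro j
    by_cases hj : Odd j
    · rw [if_pos hj, pow_succ, hj.neg_one_pow]; ring
    · rw [if_neg hj, pow_succ, (Nat.not_odd_iff_even.1 hj).neg_one_pow]; ring
  simp only [h4]
  rw [← Finset.sum_div, Finset.sum_sub_distrib, Finset.sum_add_distrib, ← Finset.mul_sum, h2, h3]
  linear_combination -(1 / 4 : ℝ) * h1

/-- Each coefficient of positive index contains a central binomial coefficient, which is even. -/
lemma exists_int_sum_legendreCoeff (d : ℕ) : ∃ m : ℤ,
    ∑ j ∈ Finset.range d, (if Odd j then (legendreCoeff d (j + 1) : ℝ) / 2 - 1 else 0) = m := by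
  have h : ∀ j : ℕ, ∃ m : ℤ,
      (if Odd j then (legendreCoeff d (j + 1) : ℝ) / 2 - 1 else 0) = m := by
    intro j
    by_cases hj : Odd j
    · obtain ⟨c, hc⟩ := Nat.two_dvd_centralBinom_of_one_le j.succ_pos
      refine ⟨((d + (j + 1)).choose (2 * (j + 1)) * c : ℕ) - 1, ?_⟩
      rw [Nat.centralBinom, Nat.succ_eq_add_one] at hc
      rw [if_pos hj, legendreCoeff, hc]
      push_cast
      ring
    · exact ⟨0, by rw [if_neg hj]; simp⟩
  choose f hf using h
  exact ⟨∑ j ∈ Finset.range d, f j, by push_cast; exact Finset.sum_congr rfl fun j _ => hf j⟩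

/-! ### The Cauchy system for the pair moments -/

lemma setIntegral_Icc_pow (a : ℕ) :
    ∫ t in Set.Icc (-1 : ℝ) 1, t ^ a = if Even a then 2 / ((a : ℝ) + 1) else 0 := by
  rw [integral_Icc_eq_integral_Ioc, ← intervalIntegral.integral_of_le (by norm_num), integral_pow]
  by_cases h : Even a
  · rw [if_pos h, (h.add_one).neg_one_pow, one_pow]
    norm_num
  · rw [if_neg h, (Nat.not_even_iff_odd.1 h).add_one.neg_one_pow, one_pow, sub_self, zero_div]

lemma setIntegral_Icc_pow_sub_one_mul_pow {e : ℕ} (he : Even e) (a : ℕ) :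
    ∫ t in Set.Icc (-1 : ℝ) 1, (t ^ e - 1) * t ^ a =
      if Even a then -2 * (e / (((a : ℝ) + 1) * (a + 1 + e))) else 0 := by
  have hint : ∀ m : ℕ, IntegrableOn (fun t : ℝ => t ^ m) (Set.Icc (-1) 1) := fun m =>
    (continuous_pow m).continuousOn.integrableOn_Icc
  simp only [sub_mul, one_mul, ← pow_add]
  rw [integral_sub (hint _) (hint _), setIntegral_Icc_pow, setIntegral_Icc_pow]
  by_cases h : Even a
  · rw [if_pos h, if_pos h, if_pos (he.add h)]
    push_cast
    have h1 : (a : ℝ) + 1 ≠ 0 := by positivity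
    have h2 : (a : ℝ) + 1 + e ≠ 0 := by positivity
    have h3 : (e : ℝ) + a + 1 ≠ 0 := by positivity
    field_simp
    ring
  · rw [if_neg h, if_neg h, if_neg fun hh => h ((Nat.even_add.1 hh).1 he), sub_self]

/-- The Cauchy system satisfied by the pair moments. -/
lemma sum_pairMoment_div {n : ℕ} {y e : Fin (n + 2)} (he : Odd (e : ℕ)) :
    ∑ a ∈ Finset.univ.filter (fun a : Fin (n + 2) => Even (a : ℕ)),
      (pairMoment n a y / ((a : ℝ) + 1)) / (((a : ℝ) + 1) + ((e : ℝ) + 1)) =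
    if e = y then vandMass (n + 2) / (4 * (n + 2) * (n + 1)) else 0 := by
  have he' : Even ((e : ℕ) + 1) := he.add_one
  -- Take U = t^(e+1) - 1; since e is odd, it vanishes at -1 as well as at 1. Its moments against
  -- odd powers are zero, so only even a remain.
  have key := coeff_mul_vandMass_eq_sum_pairMoment (n := n) (Pi.single e ((e : ℝ) + 1))
    (fun t => t ^ ((e : ℕ) + 1) - 1) (fun t => by
      have : ∑ j : Fin (n + 2), t ^ (j : ℕ) * (Pi.single e ((e : ℝ) + 1) : Fin (n + 2) → ℝ) j =
          (((e : ℕ) + 1 : ℕ) : ℝ) * t ^ (e : ℕ) := by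
        rw [Finset.sum_eq_single e]
        · simp; ring
        · intro j _ hj; simp [hj]
        · simp
      rw [this]
      simpa using (hasDerivAt_pow ((e : ℕ) + 1) t).sub_const 1)
    (by simp) (by simp [he'.neg_one_pow]) y
  simp only [setIntegral_Icc_pow_sub_one_mul_pow he', ite_mul, zero_mul] at key
  rw [← Finset.sum_filter] at key
  have h1 : ∑ a ∈ Finset.univ.filter (fun a : Fin (n + 2) => Even (a : ℕ)),
      -2 * ((((e : ℕ) + 1 : ℕ) : ℝ) / (((a : ℝ) + 1) * ((a : ℝ) + 1 + (((e : ℕ) + 1 : ℕ) : ℝ)))) *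
        pairMoment n y a = 2 * ((e : ℝ) + 1) *
      ∑ a ∈ Finset.univ.filter (fun a : Fin (n + 2) => Even (a : ℕ)),
      (pairMoment n a y / ((a : ℝ) + 1)) / (((a : ℝ) + 1) + ((e : ℝ) + 1)) := by
    rw [Finset.mul_sum]
    refine Finset.sum_congr rfl fun a _ => ?_
    rw [pairMoment_antisymm n y a]
    push_cast
    rw [div_div]
    ring
  rw [h1] at key
  have hp : (e : ℝ) + 1 ≠ 0 := by positivity
  have hn1 : (n : ℝ) + 1 ≠ 0 := by positivity
  have hn2 : (n : ℝ) + 2 ≠ 0 := by positivity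
  by_cases hey : e = y
  · subst hey
    rw [Pi.single_eq_same] at key
    rw [if_pos rfl, eq_div_iff (by positivity)]
    refine mul_left_cancel₀ hp ?_
    linear_combination -key
  · rw [Pi.single_eq_of_ne (Ne.symm hey), zero_mul] at key
    rw [if_neg hey]
    have hc : (2 * ((n : ℝ) + 2) * (n + 1)) * (2 * ((e : ℝ) + 1)) ≠ 0 := by positivity
    rw [← mul_assoc] at key
    exact (mul_eq_zero.1 key.symm).resolve_left hc

/-- Decides which alternative of `cauchy_system` applies: unknowns and equations match in number for
an even total, and there is one extra unknown for an odd total. -/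
lemma card_filter_even_fin (n : ℕ) :
    (Finset.univ.filter (fun a : Fin n => Even (a : ℕ))).card =
      (Finset.univ.filter (fun a : Fin n => Odd (a : ℕ))).card + n % 2 := by
  rw [Finset.card_filter, Finset.card_filter,
    ← Finset.sum_range (fun a => if Even a then 1 else 0),
    ← Finset.sum_range (fun a => if Odd a then 1 else 0)]
  have h : ∀ m : ℕ, ∑ a ∈ Finset.range m, (if Even a then 1 else 0) = (m + 1) / 2 ∧
      ∑ a ∈ Finset.range m, (if Odd a then 1 else 0) = m / 2 := by
    intro m
    induction m with
    | zero => simp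
    | succ m ih =>
      rw [Finset.sum_range_succ, Finset.sum_range_succ, ih.1, ih.2]
      by_cases hm : Even m
      · rw [if_pos hm, if_neg (Nat.not_odd_iff_even.2 hm)]
        have := Nat.even_iff.1 hm
        omega
      · have hm' := Nat.not_even_iff_odd.1 hm
        rw [if_neg hm, if_pos hm']
        have := Nat.odd_iff.1 hm'
        omega
  rw [(h n).1, (h n).2]
  omega

/-- Merges the two products of `cauchy_system`, over equations and over unknowns, into one product
over all indices other than y. -/
lemma prod_filter_even_mul_prod_filter_odd_erase {d : ℕ} {y : Fin d} (hy : Odd (y : ℕ))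
    (G : ℕ → ℝ) :
    (∏ e ∈ (Finset.univ.filter (fun a : Fin d => Odd (a : ℕ))).erase y, G e) *
      ∏ a ∈ Finset.univ.filter (fun a : Fin d => Even (a : ℕ)), G a =
    ∏ k ∈ (Finset.range d).erase y, G k := by
  have h1 : (Finset.univ.filter (fun a : Fin d => Odd (a : ℕ))).erase y =
      (Finset.univ.erase y).filter (fun a : Fin d => Odd (a : ℕ)) := by
    ext a; simp [and_comm]
  have h2 : Finset.univ.filter (fun a : Fin d => Even (a : ℕ)) =
      (Finset.univ.erase y).filter (fun a : Fin d => ¬Odd (a : ℕ)) := by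
    ext a
    simp only [Finset.mem_filter, Finset.mem_univ, true_and, Finset.mem_erase, and_true,
      Nat.not_odd_iff_even]
    exact ⟨fun h => ⟨fun hay => Nat.not_even_iff_odd.2 hy (hay ▸ h), h⟩, fun h => h.2⟩
  rw [h1, h2, Finset.prod_filter_mul_prod_filter_not]
  refine Finset.prod_nbij (fun k : Fin d => (k : ℕ)) ?_ ?_ ?_ fun _ _ => rfl
  · intro k hk
    have := (Finset.mem_erase.1 hk).1
    simp [Fin.val_inj, this]
  · exact fun a _ b _ h => Fin.ext h
  · intro k hk
    simp only [Finset.coe_erase, Finset.coe_range, Set.mem_sdiff, Set.mem_Iio,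
      Set.mem_singleton_iff] at hk
    exact ⟨⟨k, hk.1⟩, by simp [Fin.ext_iff, hk.2], rfl⟩

/-- The contribution of a column of pair moments to the volume with one conjugate pair. -/
lemma two_mul_sum_weight_pairMoment {n : ℕ} {y : Fin (n + 2)} (hy : Odd (y : ℕ)) :
    2 * ∑ a ∈ Finset.univ.filter (fun a : Fin (n + 2) => Even (a : ℕ)),
      (∫ p in halfDisc, pairWeight a y p) * pairMoment n a y =
    vandMass (n + 2) / ((n + 2) * (n + 1)) * (legendreCoeff (n + 2) (y + 1) / 2 - 1) := by
  set O := Finset.univ.filter (fun a : Fin (n + 2) => Even (a : ℕ)) with hO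
  set E := Finset.univ.filter (fun a : Fin (n + 2) => Odd (a : ℕ)) with hE
  set V := vandMass (n + 2) / (4 * (n + 2) * (n + 1)) with hV
  have hyE : y ∈ E := by simp [hE, hy]
  have hparity : ∀ a ∈ O, ((a : ℝ) + 1) - ((y : ℝ) + 1) ≠ 0 := by
    intro a ha h0
    have h1 : (a : ℕ) = y := by exact_mod_cast (by linarith : (a : ℝ) = y)
    have h2 : Even (a : ℕ) := (Finset.mem_filter.1 ha).2
    exact Nat.not_even_iff_odd.2 hy (h1 ▸ h2)
  -- The nodes are the shifted indices a + 1 and e + 1; `O` and `E` are named after the parity of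
  -- these nodes, not of the indices.
  have hcauchy := cauchy_system O E (fun a => (a : ℝ) + 1)
    (fun a => pairMoment n a y / ((a : ℝ) + 1)) (fun e => (e : ℝ) + 1)
    (fun a _ b _ h => Fin.ext (by simpa using h)) hyE V
    (fun a _ e _ => by positivity) hparity
    (fun e he => sum_pairMoment_div (Finset.mem_filter.1 he).2) (by
      have hc : O.card = E.card + (n + 2) % 2 := card_filter_even_fin (n + 2)
      rcases Nat.even_or_odd n with hn | hn
      · left
        have := Nat.even_iff.1 hn
        omega
      · right
        refine ⟨by have := Nat.odd_iff.1 hn; omega, ?_⟩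
        have h := sum_integral_pow_mul_pairMoment_eq_zero hn.add_one y
        simp only [setIntegral_Icc_pow, ite_mul, zero_mul] at h
        rw [← Finset.sum_filter] at h
        have h2 : ∑ a ∈ O, 2 / ((a : ℝ) + 1) * pairMoment n y a =
            -2 * ∑ a ∈ O, pairMoment n a y / ((a : ℝ) + 1) := by
          rw [Finset.mul_sum]
          refine Finset.sum_congr rfl fun a _ => ?_
          rw [pairMoment_antisymm n y a]
          ring
        rw [h2] at h
        exact (mul_eq_zero.1 h).resolve_left (by norm_num))
  have hprod := prod_filter_even_mul_prod_filter_odd_erase hy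
    (fun k => ((y : ℝ) + 1 + (k + 1)) / ((k + 1) - (y + 1)))
  rw [prod_range_erase_div y.isLt hy] at hprod
  have hself := sum_pairMoment_div (y := y) hy
  rw [if_pos rfl] at hself
  rw [mul_assoc, hprod] at hcauchy
  -- With α = a + 1 and η = y + 1, partial fractions: 2α/((η-α)(η+α)) = 1/(η-α) - 1/(α+η).
  have hterm : 2 * ∑ a ∈ O, (∫ p in halfDisc, pairWeight a y p) * pairMoment n a y =
      4 * (∑ a ∈ O, (pairMoment n a y / ((a : ℝ) + 1)) / (((y : ℝ) + 1) - ((a : ℝ) + 1)) -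
        ∑ a ∈ O, (pairMoment n a y / ((a : ℝ) + 1)) / (((a : ℝ) + 1) + ((y : ℝ) + 1))) := by
    rw [← Finset.sum_sub_distrib, Finset.mul_sum, Finset.mul_sum]
    refine Finset.sum_congr rfl fun a ha => ?_
    have hodd : Odd ((a : ℕ) + y) := (Finset.mem_filter.1 ha).2.add_odd hy
    rw [integral_halfDisc_pairWeight_of_odd hodd]
    have h1 : (a : ℝ) - y ≠ 0 := by have := hparity a ha; intro h; apply this; linarith
    have h2 : (y : ℝ) + 1 - (a + 1) ≠ 0 := by intro h; apply h1; linarith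
    have h3 : (a : ℝ) + 1 ≠ 0 := by positivity
    have h4 : (a : ℝ) + 1 + (y + 1) ≠ 0 := by positivity
    have h5 : (a : ℝ) + y + 2 ≠ 0 := by positivity
    have h6 : (y : ℝ) - a ≠ 0 := by intro h; apply h1; linarith
    rw [add_sub_add_right_eq_sub, show (a : ℝ) + 1 + (y + 1) = a + y + 2 by ring,
      ← neg_sub (y : ℝ) a, mul_neg, div_neg]
    field_simp
    ring
  rw [hterm, hcauchy, hself, hV]
  have hn1 : (n : ℝ) + 1 ≠ 0 := by positivity
  have hn2 : (n : ℝ) + 2 ≠ 0 := by positivity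
  field_simp

/-! ### The quotient of the volumes -/

/-- Weights and pair moments are both antisymmetric where the weights do not vanish, so their
products are symmetric and the double sum is twice the sum over even rows and odd columns. -/
theorem factorial_mul_contractiveVol_one (n : ℕ) :
    n.factorial * contractiveVol (n + 2) 1 = vandMass (n + 2) / ((n + 2) * (n + 1)) *
      ∑ j ∈ Finset.range (n + 2),
        (if Odd j then (legendreCoeff (n + 2) (j + 1) : ℝ) / 2 - 1 else 0) := by
  rw [(contractiveVol_one n).2]
  set f : Fin (n + 2) → Fin (n + 2) → ℝ := fun i j =>
    (∫ p in halfDisc, pairWeight i j p) * pairMoment n i j with hf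
  set g : Fin (n + 2) → Fin (n + 2) → ℝ := fun i j =>
    if Odd (j : ℕ) then (if Even (i : ℕ) then f i j else 0) else 0 with hg
  have hsymm : ∀ i j : Fin (n + 2), Odd ((i : ℕ) + j) → f i j = f j i := by
    intro i j h
    simp only [hf]
    rw [integral_halfDisc_pairWeight_of_odd h,
      integral_halfDisc_pairWeight_of_odd (by rwa [add_comm] at h), pairMoment_antisymm n i j,
      ← neg_sub (i : ℝ) j, add_comm (i : ℝ) j, mul_neg, mul_neg, div_neg]
    ring
  -- `g` keeps only even i with odd j: mixed parities hit exactly one of the two terms, and equal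
  -- parities have weight zero.
  have hfg : ∀ i j, f i j = g i j + g j i := by
    intro i j
    simp only [hg]
    by_cases hi : Even (i : ℕ) <;> by_cases hj : Even (j : ℕ)
    · have h0 : f i j = 0 := by
        simp only [hf]
        rw [integral_halfDisc_pairWeight_of_even (hi.add hj), zero_mul]
      simp [hi, hj, ← Nat.not_even_iff_odd, h0]
    · simp [hi, hj, ← Nat.not_even_iff_odd]
    · have := hsymm i j ((Nat.not_even_iff_odd.1 hi).add_even hj)
      simp [hi, hj, ← Nat.not_even_iff_odd, this]
    · have h0 : f i j = 0 := by
        simp only [hf]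
        rw [integral_halfDisc_pairWeight_of_even ((Nat.not_even_iff_odd.1 hi).add_odd
          (Nat.not_even_iff_odd.1 hj)), zero_mul]
      simp [hi, hj, h0]
  calc ∑ i, ∑ j, f i j = 2 * ∑ j, ∑ i, g i j := by
        simp only [hfg, Finset.sum_add_distrib]
        rw [Finset.sum_comm, two_mul]
    _ = _ := by
        rw [Finset.sum_range, Finset.mul_sum, Finset.mul_sum]
        refine Finset.sum_congr rfl fun j _ => ?_
        simp only [hg]
        by_cases hj : Odd (j : ℕ)
        · simp only [if_pos hj]
          rw [← Finset.sum_filter, two_mul_sum_weight_pairMoment hj]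
        · simp [if_neg hj]

theorem contractiveVol_zero_pos (d : ℕ) : 0 < contractiveVol d 0 := by
  have h := (contractiveVol_zero d).2
  have h1 : (0 : ℝ) < d.factorial := by exact_mod_cast d.factorial_pos
  exact (mul_pos_iff_of_pos_left h1).1 (h ▸ vandMass_pos d)

/-- The factor 1/((n+2)(n+1)) from the two integrated points reconciles n! with the (n+2)! of the
totally real case, so `vandMass` cancels. -/
theorem contractiveVol_one_div_zero (n : ℕ) :
    contractiveVol (n + 2) 1 / contractiveVol (n + 2) 0 = ∑ j ∈ Finset.range (n + 2),
        (if Odd j then (legendreCoeff (n + 2) (j + 1) : ℝ) / 2 - 1 else 0) := by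
  have h1 := factorial_mul_contractiveVol_one n
  have h0 := (contractiveVol_zero (n + 2)).2
  rw [← h0, Nat.factorial_succ, Nat.factorial_succ] at h1
  have hn : (n.factorial : ℝ) ≠ 0 := by exact_mod_cast n.factorial_ne_zero
  have hn1 : (n : ℝ) + 1 ≠ 0 := by positivity
  have hn2 : (n : ℝ) + 2 ≠ 0 := by positivity
  have hfac : (((n + 1 + 1) * ((n + 1) * n.factorial) : ℕ) : ℝ) =
      ((n + 2) * (n + 1)) * n.factorial := by push_cast; ring
  rw [hfac, mul_assoc _ (n.factorial : ℝ), mul_div_cancel_left₀ _ (mul_ne_zero hn2 hn1),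
    mul_assoc] at h1
  rw [div_eq_iff (contractiveVol_zero_pos (n + 2)).ne', mul_comm (∑ _ ∈ _, _)]
  exact mul_left_cancel₀ hn h1

end

theorem theorem1 (d : ℕ) (hd : 2 ≤ d) :
    (volume (contractiveSetPairs d 0) ≠ ⊤ ∧ volume (contractiveSetPairs d 1) ≠ ⊤ ∧
      0 < contractiveVol d 0) ∧
    (∃ n : ℤ, contractiveVol d 1 / contractiveVol d 0 = (n : ℝ)) ∧
    contractiveVol d 1 / contractiveVol d 0 = (legendreP d 3 - 2 * (d : ℝ) - 1) / 4 ∧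
    (∀ x : ℝ, legendreP d x =
      ∑ k ∈ Finset.range (d + 1),
        ((d + k).choose (2 * k) : ℝ) * ((2 * k).choose k : ℝ) * ((x - 1) / 2) ^ k) := by
  obtain ⟨n, rfl⟩ := Nat.exists_eq_add_of_le' hd
  refine ⟨⟨(contractiveVol_zero _).1, (contractiveVol_one n).1, contractiveVol_zero_pos _⟩,
    ?_, ?_, fun x => ?_⟩
  · rw [contractiveVol_one_div_zero]
    exact exists_int_sum_legendreCoeff (n + 2)
  · rw [contractiveVol_one_div_zero, sum_range_ite_odd_legendreCoeff]
  · rw [legendreP_eq_sum]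
    exact Finset.sum_congr rfl fun k _ => by rw [legendreCoeff, Nat.cast_mul]
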